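/- Let $s\in\mathscr{L}_2(0,\pi)$ be real-valued. For a function $y$ that is absolutely continuous on $[0,\pi]$, write $y^{[1]}_s := y'-s\,y$ for its quasi-derivative. Let each of $f$ and $F$ be either the symbol $\infty$ or a rational Herglotz--Nevanlinna function with real coefficients: $$f(\lambda)=h_0\lambda+h+\sum_{k=1}^{d}\frac{\delta_k}{h_k-\lambda},\qquad F(\lambda)=H_0\lambda+H+\sum_{k=1}^{D}\frac{\Delta_k}{H_k-\lambda},$$ where $d,D\ge 0$ are integers, $h_0,H_0\ge0$, $h,H\in\mathbb{R}$, $\delta_k,\Delta_k>0$, $h_1<\dots<h_d$ and $H_1<\dots<H_D$. Consider the boundary value problem $\mathscr{P}(s,f,F)$ with spectral parameter $\lambda\in\mathbb{C}$, $$-\bigl(y^{[1]}_s\bigr)'(x)-s(x)\,y^{[1]}_s(x)-s^2(x)\,y(x)=\lambda\,y(x)\quad\text{for a.e. }x\in(0,\pi),$$ $$\frac{y^{[1]}_s(0)}{y(0)}=-f(\lambda),\qquad \frac{y^{[1]}_s(\pi)}{y(\pi)}=F(\lambda),$$ where $y$ and $y^{[1]}_s$ are complex-valued and absolutely continuous on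 $[0,\pi]$. The boundary condition at $0$ means $y(0)=0$ if $f=\infty$ or $\lambda$ is a pole of $f$, and $y^{[1]}_s(0)=-f(\lambda)y(0)$ otherwise; the condition at $\pi$ is read in the same way. A number $\lambda\in\mathbb{C}$ is an eigenvalue if this problem has a solution $y\not\equiv0$, and such a $y$ is an eigenfunction corresponding to $\lambda$. For real $\lambda$ let $\boldsymbol{\Pi}_f(\lambda)$ be the number of poles $h_k$ of $f$ with $h_k\le\lambda$ (and $\boldsymbol{\Pi}_f(\lambda)=0$ if $f=\infty$), and define $\boldsymbol{\Pi}_F(\lambda)$ likewise. Then the eigenvalues of $\mathscr{P}(s,f,F)$ are all real and form an infinite strictly increasing sequence $\lambda_0<\lambda_1<\lambda_2<\cdots$, and for every $n\ge0$ every eigenfunction of $\mathscr{P}(s,f,F)$ corresponding to $\lambda_n$ has exactly $$n-\boldsymbol{\Pi}_f(\lambda_n)-\boldsymbol{\Pi}_F(\lambda_n)$$ zeros in the open interval $(0,\pi)$. -/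

import Mathlib

open MeasureTheory Set

namespace DistSL

/-- A rational Herglotz--Nevanlinna function with real coefficients,
`f(z) = h₀ z + h + ∑ k, δ k / (pole k - z)` with `h₀ ≥ 0`, `δ k > 0` and
`pole 0 < pole 1 < ⋯ < pole (d - 1)`. -/
structure RationalHN where
  /-- the number of poles -/
  d : ℕ
  h₀ : ℝ
  h : ℝ
  δ : Fin d → ℝ
  pole : Fin d → ℝ
  h₀_nonneg : 0 ≤ h₀
  δ_pos : ∀ k, 0 < δ k
  pole_strictMono : StrictMono pole

namespace RationalHN

/-- The value of the function at a point `z` which is not a pole. -/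
noncomputable def eval (f : RationalHN) (z : ℂ) : ℂ :=
  (f.h₀ : ℂ) * z + (f.h : ℂ) + ∑ k, (f.δ k : ℂ) / ((f.pole k : ℂ) - z)

/-- The point `z` is a pole of `f`. -/
def IsPole (f : RationalHN) (z : ℂ) : Prop := ∃ k, (f.pole k : ℂ) = z

end RationalHN

/-- A boundary coefficient: either `∞`, which encodes the Dirichlet condition, or a rational
Herglotz--Nevanlinna function. -/
inductive BoundaryCoeff where
  | infty : BoundaryCoeff
  | rational (f : RationalHN) : BoundaryCoeff

namespace BoundaryCoeff

/-- `f.Ratio z a b` is the condition `b / a = f(z)`, read as `a = 0` where `f(z) = ∞`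
(that is, if `f = ∞`, or if `z` is a pole of `f`) and as `b = f(z) * a` otherwise. -/
def Ratio : BoundaryCoeff → ℂ → ℂ → ℂ → Prop
  | infty, _, a, _ => a = 0
  | rational f, z, a, b => (f.IsPole z → a = 0) ∧ (¬ f.IsPole z → b = f.eval z * a)

open Classical in
/-- The number of poles not exceeding `t` (none if the coefficient is `∞`). -/
noncomputable def poleCount : BoundaryCoeff → ℝ → ℕ
  | infty, _ => 0
  | rational f, t => (Finset.univ.filter fun k => f.pole k ≤ t).card

end BoundaryCoeff

/-- `y` is a solution on `[0, π]` of `-(y^[1])' - s y^[1] - s² y = z y`, and `u` is its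
quasi-derivative `y^[1] = y' - s y`: both are absolutely continuous on `[0, π]`, and the two
equations `y' - s y = u` and `-u' - s u - s² y = z y` hold almost everywhere. -/
def IsSolution (s : ℝ → ℝ) (z : ℂ) (y u : ℝ → ℂ) : Prop :=
  AbsolutelyContinuousOnInterval y 0 Real.pi ∧
  AbsolutelyContinuousOnInterval u 0 Real.pi ∧
  ∀ᵐ x ∂(volume.restrict (Ioo 0 Real.pi)),
    ∃ y' u' : ℂ, HasDerivAt y y' x ∧ HasDerivAt u u' x ∧
      y' - (s x : ℂ) * y x = u x ∧
      -u' - (s x : ℂ) * u x - (s x : ℂ) ^ 2 * y x = z * y x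

/-- `y` is an eigenfunction, with eigenvalue `z`, of the boundary value problem with potential
`s'` and boundary conditions `y^[1](0) / y(0) = -f(z)`, `y^[1](π) / y(π) = F(z)`. -/
def IsEigenfunction (s : ℝ → ℝ) (f F : BoundaryCoeff) (z : ℂ) (y : ℝ → ℂ) : Prop :=
  (∃ x ∈ Icc 0 Real.pi, y x ≠ 0) ∧
  ∃ u : ℝ → ℂ, IsSolution s z y u ∧
    f.Ratio z (y 0) (-u 0) ∧ F.Ratio z (y Real.pi) (u Real.pi)

/-- `z` is an eigenvalue of the boundary value problem. -/
def IsEigenvalue (s : ℝ → ℝ) (f F : BoundaryCoeff) (z : ℂ) : Prop :=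
  ∃ y : ℝ → ℂ, IsEigenfunction s f F z y

end DistSL

/-! The proof uses the Prüfer angle. With u the quasi-derivative, the substitution y = r sin θ, u =
r cos θ turns the first-order system y' = s y + u, u' = -s u - (s² + λ) y into the scalar equation
θ' = (cos θ + s sin θ)² + λ sin² θ, which is Lipschitz in θ with an integrable constant because s is
square integrable. Both boundary conditions become angles: `BoundaryCoeff.angle` lifts -arccot of
each coefficient to a continuous nondecreasing function of λ, gaining π at each pole, so that
angle/π has integer part equal to the pole count. Start θ at the angle of f. Then λ is an eigenvalue
exactly when T(λ) = θ(π, λ) + angle of F at λ is a multiple of π.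

The comparison principle `nonneg_of_comparison` makes T strictly increasing, and a Gronwall bound
makes it continuous. T is positive, drops below π for very negative λ (`exists_pruferAngle_lt`), and
is unbounded above (`IsPruferAngle.lower_bound`). Hence T takes each value (n + 1)π exactly once, at
λ_n. Non-real eigenvalues are excluded by the Lagrange identity and the Herglotz sign of the
boundary terms.

Zeros of y are the points where θ is a multiple of π. There θ' = 1 whatever s is, so each multiple
is crossed once, upwards; counting the multiples strictly between θ(0) and θ(π) = (n + 1)π - angle
of F gives the formula, the pole counts being the integer parts of the two boundary angles
(`IsPruferAngle.ncard_zeros`). -/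

namespace DistSL

/-! ### Calculus of absolutely continuous functions. -/

/-- `f` is absolutely continuous on `[a, b]`, with derivative `f'` almost everywhere. -/
structure HasACDeriv {E : Type*} [NormedAddCommGroup E] [NormedSpace ℝ E]
    (f f' : ℝ → E) (a b : ℝ) : Prop where
  ac : AbsolutelyContinuousOnInterval f a b
  deriv : ∀ᵐ x, x ∈ Ioo a b → HasDerivAt f (f' x) x

theorem absolutelyContinuousOnInterval_comp_lipschitz {X Y : Type*} [PseudoMetricSpace X]
    [PseudoMetricSpace Y] {f : ℝ → X} {φ : X → Y} {K : NNReal} {t : Set X} {a b : ℝ}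
    (hφ : LipschitzOnWith K φ t) (hf : AbsolutelyContinuousOnInterval f a b)
    (hm : MapsTo f (uIcc a b) t) :
    AbsolutelyContinuousOnInterval (fun x => φ (f x)) a b := by
  rw [absolutelyContinuousOnInterval_iff] at hf ⊢
  intro ε hε
  obtain ⟨δ, hδ, h⟩ := hf (ε / (K + 1)) (by positivity)
  refine ⟨δ, hδ, fun E hE hE' => ?_⟩
  have h1 := h E hE hE'
  calc ∑ i ∈ Finset.range E.1, dist (φ (f (E.2 i).1)) (φ (f (E.2 i).2))
      ≤ ∑ i ∈ Finset.range E.1, (K : ℝ) * dist (f (E.2 i).1) (f (E.2 i).2) := by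
        refine Finset.sum_le_sum fun i hi => hφ.dist_le_mul _ (hm ?_) _ (hm ?_)
        · exact (hE.1 i hi).1
        · exact (hE.1 i hi).2
    _ = K * ∑ i ∈ Finset.range E.1, dist (f (E.2 i).1) (f (E.2 i).2) := by
        rw [Finset.mul_sum]
    _ ≤ K * (ε / (K + 1)) := by gcongr
    _ < ε := by
        rw [mul_div_assoc', div_lt_iff₀ (by positivity)]
        nlinarith

namespace HasACDeriv

section Vector

variable {E : Type*} [NormedAddCommGroup E] [NormedSpace ℝ E] {f g f' g' : ℝ → E} {a b : ℝ}

theorem congr_deriv (hf : HasACDeriv f f' a b)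
    (h : ∀ᵐ x, x ∈ Ioo a b → f' x = g' x) : HasACDeriv f g' a b := by
  refine ⟨hf.ac, ?_⟩
  filter_upwards [hf.deriv, h] with x h1 h2 hx
  exact h2 hx ▸ h1 hx

theorem const (c : E) (a b : ℝ) : HasACDeriv (fun _ => c) (fun _ => 0) a b :=
  ⟨contDiffOn_const.absolutelyContinuousOnInterval, .of_forall fun x _ => hasDerivAt_const x c⟩

theorem add (hf : HasACDeriv f f' a b) (hg : HasACDeriv g g' a b) :
    HasACDeriv (fun x => f x + g x) (fun x => f' x + g' x) a b := by
  refine ⟨hf.ac.fun_add hg.ac, ?_⟩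
  filter_upwards [hf.deriv, hg.deriv] with x h1 h2 hx using (h1 hx).add (h2 hx)

theorem sub (hf : HasACDeriv f f' a b) (hg : HasACDeriv g g' a b) :
    HasACDeriv (fun x => f x - g x) (fun x => f' x - g' x) a b := by
  refine ⟨hf.ac.fun_sub hg.ac, ?_⟩
  filter_upwards [hf.deriv, hg.deriv] with x h1 h2 hx using (h1 hx).sub (h2 hx)

theorem neg (hf : HasACDeriv f f' a b) :
    HasACDeriv (fun x => - f x) (fun x => - f' x) a b := by
  refine ⟨hf.ac.fun_neg, ?_⟩
  filter_upwards [hf.deriv] with x h1 hx using (h1 hx).neg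

theorem mono (hf : HasACDeriv f f' a b) {c d : ℝ} (hac : a ≤ c) (hcd : c ≤ d) (hdb : d ≤ b) :
    HasACDeriv f f' c d := by
  refine ⟨hf.ac.mono ?_, ?_⟩
  · rw [uIcc_of_le hcd, uIcc_of_le (by linarith)]
    exact Icc_subset_Icc hac hdb
  · filter_upwards [hf.deriv] with x h1 hx using h1 ⟨by linarith [hx.1], by linarith [hx.2]⟩

theorem continuousOn (hf : HasACDeriv f f' a b) (hab : a ≤ b) : ContinuousOn f (Icc a b) := by
  simpa [uIcc_of_le hab] using hf.ac.continuousOn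

theorem clm_comp {F : Type*} [NormedAddCommGroup F] [NormedSpace ℝ F] (T : E →L[ℝ] F)
    (hf : HasACDeriv f f' a b) : HasACDeriv (fun x => T (f x)) (fun x => T (f' x)) a b := by
  refine ⟨absolutelyContinuousOnInterval_comp_lipschitz (t := univ) T.lipschitz.lipschitzOnWith
    hf.ac (mapsTo_univ _ _), ?_⟩
  filter_upwards [hf.deriv] with x h1 hx using T.hasFDerivAt.comp_hasDerivAt x (h1 hx)

theorem eq_of_deriv_eq_zero (hf : HasACDeriv f (fun _ => 0) a b) (hab : a ≤ b) {x : ℝ}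
    (hx : x ∈ Icc a b) : f x = f a := by
  obtain ⟨C, hC⟩ := hf.ac.const_of_ae_hasDerivAt_zero (by
    rw [uIcc_of_le hab]
    have h₁ : ∀ᵐ x : ℝ, x ≠ a := by simp [ae_iff, measure_singleton]
    have h₂ : ∀ᵐ x : ℝ, x ≠ b := by simp [ae_iff, measure_singleton]
    filter_upwards [hf.deriv, h₁, h₂] with x h1 h2 h3 hx
    exact h1 ⟨lt_of_le_of_ne hx.1 (Ne.symm h2), lt_of_le_of_ne hx.2 h3⟩)
  rw [uIcc_of_le hab] at hC
  rw [hC x hx, hC a (left_mem_Icc.2 hab)]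

end Vector

section Algebra

variable {A : Type*} [NormedRing A] [NormedAlgebra ℝ A] [NormMulClass A] {f g f' g' : ℝ → A}
  {a b : ℝ}

theorem mul (hf : HasACDeriv f f' a b) (hg : HasACDeriv g g' a b) :
    HasACDeriv (fun x => f x * g x) (fun x => f' x * g x + f x * g' x) a b := by
  refine ⟨hf.ac.fun_smul hg.ac, ?_⟩
  filter_upwards [hf.deriv, hg.deriv] with x h1 h2 hx using (h1 hx).mul (h2 hx)

end Algebra

section Real

variable {f f' : ℝ → ℝ} {a b : ℝ}

/-- An absolutely continuous function is bounded on the interval, and a C¹ function is Lipschitz on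
the compact interval of its values. -/
theorem comp_contDiff {E : Type*} [NormedAddCommGroup E] [NormedSpace ℝ E] {φ φ' : ℝ → E}
    (hφ : ContDiff ℝ 1 φ) (hφ' : ∀ t, HasDerivAt φ (φ' t) t) (hf : HasACDeriv f f' a b) :
    HasACDeriv (fun x => φ (f x)) (fun x => f' x • φ' (f x)) a b := by
  obtain ⟨C, hC⟩ := hf.ac.exists_bound
  obtain ⟨K, hK⟩ := (hφ.contDiffOn (s := Icc (-C) C)).exists_lipschitzOnWith (by decide)
    (convex_Icc _ _) isCompact_Icc
  refine ⟨absolutelyContinuousOnInterval_comp_lipschitz hK hf.ac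
    fun x hx => abs_le.1 (hC x hx), ?_⟩
  filter_upwards [hf.deriv] with x h1 hx using (hφ' (f x)).scomp x (h1 hx)

theorem deriv_ae_eq (hf : HasACDeriv f f' a b) (hab : a ≤ b) :
    ∀ᵐ x, x ∈ uIoc a b → _root_.deriv f x = f' x := by
  have h₂ : ∀ᵐ x : ℝ, x ≠ b := by simp [ae_iff, measure_singleton]
  filter_upwards [hf.deriv, h₂] with x h1 h3 hx
  rw [uIoc_of_le hab] at hx
  exact (h1 ⟨hx.1, lt_of_le_of_ne hx.2 h3⟩).deriv

theorem intervalIntegrable (hf : HasACDeriv f f' a b) (hab : a ≤ b) :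
    IntervalIntegrable f' volume a b :=
  hf.ac.intervalIntegrable_deriv.congr_ae
    ((ae_restrict_iff' measurableSet_uIoc).2 (hf.deriv_ae_eq hab))

theorem integral_eq_sub (hf : HasACDeriv f f' a b) (hab : a ≤ b) :
    ∫ x in a..b, f' x = f b - f a := by
  rw [← hf.ac.integral_deriv_eq_sub]
  refine intervalIntegral.integral_congr_ae ?_
  filter_upwards [hf.deriv_ae_eq hab] with x h hx using (h hx).symm

theorem of_integral {g : ℝ → ℝ} (hg : IntervalIntegrable g volume a b) (hab : a ≤ b) :
    HasACDeriv (fun x => ∫ t in a..x, g t) g a b := by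
  refine ⟨hg.absolutelyContinuousOnInterval_intervalIntegral left_mem_uIcc, ?_⟩
  filter_upwards [hg.ae_hasDerivAt_integral] with x h hx
  exact h (by rw [uIcc_of_le hab]; exact Ioo_subset_Icc_self hx) a left_mem_uIcc

theorem monotoneOn (hf : HasACDeriv f f' a b) (h : ∀ᵐ x, x ∈ Ioo a b → 0 ≤ f' x) :
    MonotoneOn f (Icc a b) := by
  intro x hx y hy hxy
  have h1 := hf.mono hx.1 hxy hy.2
  have h2 := h1.integral_eq_sub hxy
  have h₂ : ∀ᵐ x : ℝ, x ≠ b := by simp [ae_iff, measure_singleton]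
  have h3 : 0 ≤ ∫ t in x..y, f' t := by
    refine intervalIntegral.integral_nonneg_of_ae_restrict hxy ?_
    refine (ae_restrict_iff' measurableSet_Icc).2 ?_
    have h₁ : ∀ᵐ x : ℝ, x ≠ a := by simp [ae_iff, measure_singleton]
    filter_upwards [h, h₁, h₂] with t ht h4 h5 h6
    exact ht ⟨lt_of_le_of_ne (hx.1.trans h6.1) (Ne.symm h4), lt_of_le_of_ne (h6.2.trans hy.2) h5⟩
  linarith

/-- A function which is constant on `[a, b]` has vanishing derivative almost everywhere. -/
theorem deriv_eq_zero_of_const {E : Type*} [NormedAddCommGroup E] [NormedSpace ℝ E]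
    {f f' : ℝ → E} (hf : HasACDeriv f f' a b) {c : E} (h : ∀ x ∈ Ioo a b, f x = c) :
    ∀ᵐ x, x ∈ Ioo a b → f' x = 0 := by
  filter_upwards [hf.deriv] with x h1 hx
  have : HasDerivAt f 0 x := (hasDerivAt_const x c).congr_of_eventuallyEq
    (Filter.eventually_of_mem (isOpen_Ioo.mem_nhds hx) h)
  exact (h1 hx).unique this

end Real

end HasACDeriv

/-! ### Gronwall-type comparison. -/

/-- A continuous function which vanishes almost everywhere on `(a, b)` vanishes on `[a, b]`. -/
theorem eq_zero_of_ae_eq_zero {E : Type*} [NormedAddCommGroup E] {f : ℝ → E} {a b : ℝ}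
    (hab : a < b) (hf : ContinuousOn f (Icc a b)) (h : ∀ᵐ x, x ∈ Ioo a b → f x = 0) :
    ∀ x ∈ Icc a b, f x = 0 := by
  have := Measure.eqOn_Icc_of_ae_eq volume hab.ne (f := f) (g := fun _ => 0) (by
    rw [Filter.EventuallyEq, ← restrict_Ioo_eq_restrict_Icc]
    exact (ae_restrict_iff' measurableSet_Ioo).2 h) hf continuousOn_const
  exact this

/-- Gronwall's argument: if `D' = b D + g` with `|b| ≤ L`, then `D e^{-∫ b}` has derivative
`g e^{-∫ b}`. -/
theorem exists_integrating_factor {D D' g L : ℝ → ℝ} {a b : ℝ} (hab : a ≤ b)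
    (hD : HasACDeriv D D' a b) (hg : IntervalIntegrable g volume a b)
    (hL : IntervalIntegrable L volume a b)
    (h : ∀ᵐ x, x ∈ Ioo a b → |D' x - g x| ≤ L x * |D x|) :
    ∃ B : ℝ → ℝ, B a = 0 ∧ (∀ x ∈ Icc a b, |B x| ≤ ∫ t in a..b, |L t|) ∧
      HasACDeriv (fun x => D x * Real.exp (-B x)) (fun x => g x * Real.exp (-B x)) a b := by
  -- Where D = 0 the hypothesis forces D' = g, so the convention x / 0 = 0 keeps D' - g = β D valid
  -- there. No sign or regularity of b is needed, only |β| ≤ |L|.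
  set β : ℝ → ℝ := fun x => (D' x - g x) / D x with hβdef
  have h₂ : ∀ᵐ x : ℝ, x ≠ b := by simp [ae_iff, measure_singleton]
  have hβle : ∀ᵐ x, x ∈ Ioo a b → |β x| ≤ |L x| := by
    filter_upwards [h] with x hx hx'
    by_cases h0 : D x = 0
    · simp [hβdef, h0]
    · rw [hβdef, abs_div, div_le_iff₀ (abs_pos.2 h0)]
      exact (hx hx').trans (by gcongr; exact le_abs_self _)
  have hD' := hD.intervalIntegrable hab
  have hβ : IntervalIntegrable β volume a b := by
    rw [intervalIntegrable_iff, uIoc_of_le hab] at *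
    refine Integrable.mono' hL.abs ?_ ?_
    · refine AEMeasurable.aestronglyMeasurable (AEMeasurable.div ?_ ?_)
      · exact (hD'.1.sub hg.1).aemeasurable
      · exact ((hD.continuousOn hab).mono Ioc_subset_Icc_self).aemeasurable measurableSet_Ioc
    · refine (ae_restrict_iff' measurableSet_Ioc).2 ?_
      filter_upwards [hβle, h₂] with x h1 h2 h3
      exact h1 ⟨h3.1, lt_of_le_of_ne h3.2 h2⟩
  have hB := HasACDeriv.of_integral hβ hab
  refine ⟨fun x => ∫ t in a..x, β t, by simp, ?_, ?_⟩
  · intro x hx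
    have i1 : IntervalIntegrable β volume a x := hβ.mono_set (by
      rw [uIcc_of_le hab, uIcc_of_le hx.1]; exact Icc_subset_Icc_right hx.2)
    have i2 : IntervalIntegrable L volume a x := hL.mono_set (by
      rw [uIcc_of_le hab, uIcc_of_le hx.1]; exact Icc_subset_Icc_right hx.2)
    calc |∫ t in a..x, β t| ≤ ∫ t in a..x, |β t| := intervalIntegral.abs_integral_le_integral_abs hx.1
      _ ≤ ∫ t in a..x, |L t| := by
        refine intervalIntegral.integral_mono_ae_restrict hx.1 i1.abs i2.abs ?_
        rw [← restrict_Ioo_eq_restrict_Icc]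
        refine (ae_restrict_iff' measurableSet_Ioo).2 ?_
        filter_upwards [hβle] with t h1 h2 using h1 ⟨h2.1, h2.2.trans_le hx.2⟩
      _ ≤ ∫ t in a..b, |L t| :=
        intervalIntegral.integral_mono_interval le_rfl hx.1 hx.2
          (.of_forall fun t => abs_nonneg _) hL.abs
  · have e := (hB.neg).comp_contDiff (φ := Real.exp) (φ' := Real.exp) Real.contDiff_exp
      Real.hasDerivAt_exp
    refine (hD.mul e).congr_deriv ?_
    filter_upwards [h] with x hx hx'
    have : D' x - g x = β x * D x := by
      by_cases h0 : D x = 0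
      · have := hx hx'
        rw [h0] at this ⊢
        simpa using this
      · rw [hβdef]; field_simp
    simp only [smul_eq_mul]
    linear_combination Real.exp (-∫ t in a..x, β t) * this

section Comparison

variable {D D' g L : ℝ → ℝ} {a b : ℝ}

/-- The product D e^{-B} is nondecreasing. If it vanishes at x, it is squeezed to 0 on all of (a,
x), so its derivative g e^{-B} vanishes there; this equality case is what later yields strict
inequalities. -/
theorem nonneg_of_comparison (hab : a ≤ b)
    (hD : HasACDeriv D D' a b) (hg : IntervalIntegrable g volume a b)
    (hL : IntervalIntegrable L volume a b)
    (h : ∀ᵐ x, x ∈ Ioo a b → |D' x - g x| ≤ L x * |D x|)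
    (h0 : 0 ≤ D a) (hg0 : ∀ᵐ x, x ∈ Ioo a b → 0 ≤ g x) {x : ℝ} (hx : x ∈ Icc a b) :
    0 ≤ D x ∧ (D x = 0 → ∀ᵐ t, t ∈ Ioo a x → g t = 0) := by
  obtain ⟨B, hB0, -, hB⟩ := exists_integrating_factor hab hD hg hL h
  have hmono := hB.monotoneOn (by
    filter_upwards [hg0] with t ht ht'
    exact mul_nonneg (ht ht') (Real.exp_pos _).le)
  have ha : a ∈ Icc a b := left_mem_Icc.2 hab
  have key : ∀ t ∈ Icc a b, 0 ≤ D t * Real.exp (-B t) := fun t ht =>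
    (mul_nonneg h0 (Real.exp_pos _).le).trans (hmono ha ht ht.1)
  refine ⟨nonneg_of_mul_nonneg_left (key x hx) (Real.exp_pos _), fun hx0 => ?_⟩
  have hz : ∀ t ∈ Ioo a x, D t * Real.exp (-B t) = 0 := by
    intro t ht
    have ht' : t ∈ Icc a b := ⟨ht.1.le, ht.2.le.trans hx.2⟩
    have := hmono ht' hx ht.2.le
    simp only [hx0, zero_mul] at this
    exact le_antisymm this (key t ht')
  filter_upwards [(hB.mono le_rfl hx.1 hx.2).deriv_eq_zero_of_const hz] with t h1 h2
  exact (mul_eq_zero.1 (h1 h2)).resolve_right (Real.exp_pos _).ne'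

/-- Integrate (D e^{-B})' = g e^{-B} and bound both exponentials by e^M with M = ∫ |L|. It serves to
prove continuous dependence on λ and on the initial angle. -/
theorem abs_le_of_comparison (hab : a ≤ b)
    (hD : HasACDeriv D D' a b) (hg : IntervalIntegrable g volume a b)
    (hL : IntervalIntegrable L volume a b)
    (h : ∀ᵐ x, x ∈ Ioo a b → |D' x - g x| ≤ L x * |D x|) {C : ℝ}
    (hgC : ∀ᵐ x, x ∈ Ioo a b → |g x| ≤ C) :
    |D b| ≤ Real.exp (∫ t in a..b, |L t|) *
      (|D a| + C * Real.exp (∫ t in a..b, |L t|) * (b - a)) := by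
  obtain ⟨B, hB0, hBL, hB⟩ := exists_integrating_factor hab hD hg hL h
  set M := ∫ t in a..b, |L t|
  have h1 := hB.integral_eq_sub hab
  have h2 : ‖∫ t in a..b, g t * Real.exp (-B t)‖ ≤ C * Real.exp M * |b - a| := by
    refine intervalIntegral.norm_integral_le_of_norm_le_const_ae ?_
    have h₂ : ∀ᵐ x : ℝ, x ≠ b := by simp [ae_iff, measure_singleton]
    filter_upwards [hgC, h₂] with x h3 h4 h5
    rw [uIoc_of_le hab] at h5
    have h6 := h3 ⟨h5.1, lt_of_le_of_ne h5.2 h4⟩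
    rw [Real.norm_eq_abs, abs_mul, Real.abs_exp]
    have h7 := abs_le.1 (hBL x ⟨h5.1.le, h5.2⟩)
    have : Real.exp (-B x) ≤ Real.exp M := Real.exp_le_exp.2 (by linarith [h7.1])
    have := (abs_nonneg _).trans h6
    gcongr
  rw [h1, Real.norm_eq_abs, abs_of_nonneg (sub_nonneg.2 hab), hB0, neg_zero, Real.exp_zero,
    mul_one] at h2
  have h3 : |D b * Real.exp (-B b)| ≤ |D a| + C * Real.exp M * (b - a) := by
    have := abs_sub_abs_le_abs_sub (D b * Real.exp (-B b)) (D a)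
    linarith
  have h4 : D b = Real.exp (B b) * (D b * Real.exp (-B b)) := by
    rw [Real.exp_neg]; field_simp
  rw [h4, abs_mul, Real.abs_exp]
  have h5 : Real.exp (B b) ≤ Real.exp M :=
    Real.exp_le_exp.2 (abs_le.1 (hBL b (right_mem_Icc.2 hab))).2
  have := (abs_nonneg _).trans h3
  gcongr

end Comparison

/-! ### Carathéodory existence by a weighted fixed point. -/

/-- Existence for the Carathéodory initial value problem with an integrable Lipschitz bound. -/
theorem exists_caratheodory_solution {G : ℝ → ℝ → ℝ} {L : ℝ → ℝ} {a b : ℝ} (hab : a ≤ b)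
    (hL : IntervalIntegrable L volume a b) (hL0 : ∀ x, 0 ≤ L x)
    (hG : ∀ θ : ℝ → ℝ, Continuous θ → IntervalIntegrable (fun x => G x (θ x)) volume a b)
    (hlip : ∀ x u v, |G x u - G x v| ≤ L x * |u - v|) (c : ℝ) :
    ∃ θ : ℝ → ℝ, θ a = c ∧ HasACDeriv θ (fun x => G x (θ x)) a b := by
  -- Bielecki's weight: measuring functions against e^k with k' = 2L makes the Picard operator a
  -- contraction with constant 1/2 on the whole interval, so no gluing of short intervals is needed.
  set k : ℝ → ℝ := fun x => ∫ t in a..x, 2 * L t with hk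
  have hL2 : IntervalIntegrable (fun t => 2 * L t) volume a b := hL.const_mul 2
  have hkd : HasACDeriv k (fun t => 2 * L t) a b := .of_integral hL2 hab
  set κ : ℝ → ℝ := IccExtend hab (fun x : Icc a b => k x) with hκ
  have hkcont : ContinuousOn k (Icc a b) := hkd.continuousOn hab
  have hκc : Continuous κ := (continuousOn_iff_continuous_domRestrict.1 hkcont).Icc_extend'
  have hκk : ∀ x ∈ Icc a b, κ x = k x := fun x hx => by
    rw [hκ, IccExtend_of_mem hab _ hx]
  -- the candidate obtained from a weighted continuous function
  let ext : C(Icc a b, ℝ) → ℝ → ℝ := fun v x => Real.exp (κ x) * IccExtend hab v x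
  have hext : ∀ v, Continuous (ext v) := fun v =>
    (Real.continuous_exp.comp hκc).mul v.continuous.Icc_extend'
  let P : C(Icc a b, ℝ) → ℝ → ℝ := fun v x => c + ∫ t in a..x, G t (ext v t)
  have hP : ∀ v, HasACDeriv (P v) (fun x => G x (ext v x)) a b := fun v =>
    ((HasACDeriv.const c a b).add (.of_integral (hG _ (hext v)) hab)).congr_deriv
      (.of_forall fun x _ => zero_add _)
  let T : C(Icc a b, ℝ) → C(Icc a b, ℝ) := fun v =>
    ⟨fun x => Real.exp (-κ x) * P v x,
      ((Real.continuous_exp.comp hκc.neg).comp continuous_subtype_val).mul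
        (continuousOn_iff_continuous_domRestrict.1 ((hP v).continuousOn hab))⟩
  have hT : ContractingWith (1 / 2) T := by
    refine ⟨by norm_num, LipschitzWith.of_dist_le_mul fun v w => ?_⟩
    rw [ContinuousMap.dist_le (by positivity)]
    intro x
    have hd := dist_nonneg (x := v) (y := w)
    have hx := x.2
    have hE := (hkd.comp_contDiff (φ := Real.exp) Real.contDiff_exp Real.hasDerivAt_exp).mono
      le_rfl hx.1 hx.2
    have hEi := hE.integral_eq_sub hx.1
    have hdiff := (((hP v).sub (hP w)).mono le_rfl hx.1 hx.2)
    have hdi := hdiff.integral_eq_sub hx.1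
    have hbd : ‖∫ t in a..x.1, (G t (ext v t) - G t (ext w t))‖ ≤
        ∫ t in a..x.1, dist v w / 2 * ((2 * L t) • Real.exp (k t)) := by
      refine intervalIntegral.norm_integral_le_of_norm_le hx.1 (.of_forall fun t ht => ?_)
        ((hE.intervalIntegrable hx.1).const_mul _)
      have htI : t ∈ Icc a b := ⟨ht.1.le, ht.2.trans hx.2⟩
      refine (hlip t _ _).trans ?_
      have : |ext v t - ext w t| ≤ Real.exp (k t) * dist v w := by
        simp only [ext, ← mul_sub, abs_mul, Real.abs_exp, hκk t htI]
        gcongr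
        rw [IccExtend_of_mem hab _ htI, IccExtend_of_mem hab _ htI]
        exact ContinuousMap.dist_apply_le_dist (f := v) (g := w) ⟨t, htI⟩
      calc L t * |ext v t - ext w t| ≤ L t * (Real.exp (k t) * dist v w) := by
            gcongr; exact hL0 t
        _ = _ := by simp only [smul_eq_mul]; ring
    rw [intervalIntegral.integral_const_mul, hEi, hdi] at hbd
    have hPa : ∀ u, P u a = c := fun u => by simp [P]
    have hka : k a = 0 := by simp [hk]
    rw [hPa, hPa, sub_self, sub_zero, hka, Real.exp_zero] at hbd
    change |Real.exp (-κ x) * P v x - Real.exp (-κ x) * P w x| ≤ _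
    rw [← mul_sub, abs_mul, Real.abs_exp, hκk _ hx]
    calc Real.exp (-k x) * |P v x - P w x|
        ≤ Real.exp (-k x) * (dist v w / 2 * (Real.exp (k x) - 1)) := by
          gcongr; exact hbd
      _ = dist v w / 2 * (1 - Real.exp (-k x)) := by
          rw [Real.exp_neg]; field_simp
      _ ≤ dist v w / 2 * 1 := by
          gcongr; linarith [Real.exp_pos (-k x)]
      _ = _ := by push_cast; ring
  set v := hT.fixedPoint T
  have hv : T v = v := hT.fixedPoint_isFixedPt
  have hPext : ∀ x ∈ Icc a b, P v x = ext v x := by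
    intro x hx
    have h1 : (T v) ⟨x, hx⟩ = v ⟨x, hx⟩ := by rw [hv]
    change Real.exp (-κ x) * P v x = _ at h1
    simp only [ext]
    rw [IccExtend_of_mem hab _ hx, ← h1, Real.exp_neg]
    field_simp
  refine ⟨P v, by simp [P], (hP v).congr_deriv (.of_forall fun x hx => ?_)⟩
  rw [hPext x (Ioo_subset_Icc_self hx)]

/-! ### The Prüfer equation. -/

theorem intervalIntegrable_of_memLp {s : ℝ → ℝ}
    (hs : MemLp s 2 (volume.restrict (Ioo 0 Real.pi))) :
    IntervalIntegrable s volume 0 Real.pi := by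
  rw [intervalIntegrable_iff, uIoc_of_le Real.pi_pos.le, IntegrableOn,
    ← restrict_Ioo_eq_restrict_Ioc]
  exact hs.integrable (by norm_num)

theorem intervalIntegrable_sq_of_memLp {s : ℝ → ℝ}
    (hs : MemLp s 2 (volume.restrict (Ioo 0 Real.pi))) :
    IntervalIntegrable (fun x => s x ^ 2) volume 0 Real.pi := by
  rw [intervalIntegrable_iff, uIoc_of_le Real.pi_pos.le, IntegrableOn,
    ← restrict_Ioo_eq_restrict_Ioc]
  exact hs.integrable_sq

/-- The right-hand side of the equation for the Prüfer angle. -/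
noncomputable def pruferField (s : ℝ → ℝ) (l x θ : ℝ) : ℝ :=
  (Real.cos θ + s x * Real.sin θ) ^ 2 + l * Real.sin θ ^ 2

theorem pruferField_eq (s : ℝ → ℝ) (l x θ : ℝ) : pruferField s l x θ =
    Real.cos θ ^ 2 + s x * (2 * Real.cos θ * Real.sin θ) +
      s x ^ 2 * Real.sin θ ^ 2 + l * Real.sin θ ^ 2 := by
  unfold pruferField; ring

theorem pruferField_of_sin_eq_zero (s : ℝ → ℝ) (l x : ℝ) {θ : ℝ} (h : Real.sin θ = 0) :
    pruferField s l x θ = 1 := by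
  have := Real.sin_sq_add_cos_sq θ
  rw [pruferField_eq, h] at *
  linarith

theorem pruferField_sub (s : ℝ → ℝ) (l l' x θ : ℝ) :
    pruferField s l x θ - pruferField s l' x θ = (l - l') * Real.sin θ ^ 2 := by
  unfold pruferField; ring

/-- The Lipschitz bound for the Prüfer equation. -/
def pruferLip (s : ℝ → ℝ) (l x : ℝ) : ℝ := 2 + 2 * s x ^ 2 + |l|

theorem pruferLip_nonneg (s : ℝ → ℝ) (l x : ℝ) : 0 ≤ pruferLip s l x := by
  unfold pruferLip; positivity

theorem abs_sin_sub_sin_le (u v : ℝ) : |Real.sin u - Real.sin v| ≤ |u - v| := by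
  rw [Real.sin_sub_sin, abs_mul, abs_mul, abs_two]
  have h1 := Real.abs_sin_le_abs (x := (u - v) / 2)
  have h2 := Real.abs_cos_le_one ((u + v) / 2)
  rw [abs_div, abs_two] at h1
  nlinarith [abs_nonneg (Real.sin ((u - v) / 2)), abs_nonneg (Real.cos ((u + v) / 2))]

theorem abs_cos_sub_cos_le (u v : ℝ) : |Real.cos u - Real.cos v| ≤ |u - v| := by
  have := abs_sin_sub_sin_le (u + Real.pi / 2) (v + Real.pi / 2)
  rwa [Real.sin_add_pi_div_two, Real.sin_add_pi_div_two, add_sub_add_right_eq_sub] at this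

theorem pruferField_lipschitz (s : ℝ → ℝ) (l x u v : ℝ) :
    |pruferField s l x u - pruferField s l x v| ≤ pruferLip s l x * |u - v| := by
  -- In double angles the field is affine in cos 2w and sin 2w, each 2-Lipschitz in w.
  have e : ∀ w, pruferField s l x w = (1 + s x ^ 2 + l) / 2 +
      (1 - s x ^ 2 - l) / 2 * Real.cos (2 * w) + s x * Real.sin (2 * w) := by
    intro w
    rw [pruferField_eq, Real.cos_two_mul, Real.sin_two_mul]
    linear_combination (s x ^ 2 + l) * Real.sin_sq_add_cos_sq w
  have h1 := abs_cos_sub_cos_le (2 * u) (2 * v)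
  have h2 := abs_sin_sub_sin_le (2 * u) (2 * v)
  rw [← mul_sub, abs_mul, abs_two] at h1 h2
  have h3 : pruferField s l x u - pruferField s l x v =
      (1 - s x ^ 2 - l) / 2 * (Real.cos (2 * u) - Real.cos (2 * v)) +
        s x * (Real.sin (2 * u) - Real.sin (2 * v)) := by
    rw [e, e]; ring
  have h4 : |(1 - s x ^ 2 - l) / 2| ≤ (1 + s x ^ 2 + |l|) / 2 := by
    rw [abs_le]
    constructor <;> linarith [neg_abs_le l, le_abs_self l, sq_nonneg (s x)]
  have h5 : 2 * |s x| ≤ 1 + s x ^ 2 := by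
    nlinarith [sq_abs (s x), sq_nonneg (|s x| - 1)]
  rw [h3]
  calc _ ≤ |(1 - s x ^ 2 - l) / 2| * |Real.cos (2 * u) - Real.cos (2 * v)| +
        |s x| * |Real.sin (2 * u) - Real.sin (2 * v)| := by
        rw [← abs_mul, ← abs_mul]; exact abs_add_le _ _
    _ ≤ (1 + s x ^ 2 + |l|) / 2 * (2 * |u - v|) + |s x| * (2 * |u - v|) := by gcongr
    _ = (1 + s x ^ 2 + |l| + 2 * |s x|) * |u - v| := by ring
    _ ≤ pruferLip s l x * |u - v| := by
        unfold pruferLip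
        refine mul_le_mul_of_nonneg_right ?_ (abs_nonneg _)
        linarith

/-- Puts the difference of two angles into the comparison setting: the change of spectral parameter
is the forcing term (l' - l) sin² u, and the rest is Lipschitz with a constant depending only on l.
-/
theorem pruferField_sub_comparison (s : ℝ → ℝ) (l l' t u v : ℝ) :
    |(pruferField s l' t u - pruferField s l t v) - (l' - l) * Real.sin u ^ 2| ≤
      pruferLip s l t * |u - v| := by
  have := pruferField_lipschitz s l t u v
  rw [← pruferField_sub s l' l t u]
  convert this using 2
  ring

theorem intervalIntegrable_pruferLip {s : ℝ → ℝ}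
    (hs : MemLp s 2 (volume.restrict (Ioo 0 Real.pi))) (l : ℝ) :
    IntervalIntegrable (pruferLip s l) volume 0 Real.pi :=
  (intervalIntegrable_const.add ((intervalIntegrable_sq_of_memLp hs).const_mul 2)).add
    intervalIntegrable_const

theorem intervalIntegrable_pruferField {s : ℝ → ℝ}
    (hs : MemLp s 2 (volume.restrict (Ioo 0 Real.pi))) (l : ℝ) {θ : ℝ → ℝ}
    (hθ : ContinuousOn θ (Icc 0 Real.pi)) :
    IntervalIntegrable (fun x => pruferField s l x (θ x)) volume 0 Real.pi := by
  simp only [pruferField_eq]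
  rw [← uIcc_of_le Real.pi_pos.le] at hθ
  have h1 : ContinuousOn (fun x => Real.sin (θ x)) (uIcc 0 Real.pi) :=
    Real.continuous_sin.comp_continuousOn hθ
  have h2 : ContinuousOn (fun x => Real.cos (θ x)) (uIcc 0 Real.pi) :=
    Real.continuous_cos.comp_continuousOn hθ
  exact (((h2.pow 2).intervalIntegrable.add ((intervalIntegrable_of_memLp hs).mul_continuousOn
    ((continuousOn_const.mul h2).mul h1))).add
    ((intervalIntegrable_sq_of_memLp hs).mul_continuousOn (h1.pow 2))).add
    (continuousOn_const.mul (h1.pow 2)).intervalIntegrable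

/-- `θ` solves the Prüfer equation on `[0, π]`. -/
def IsPruferAngle (s : ℝ → ℝ) (l : ℝ) (θ : ℝ → ℝ) : Prop :=
  HasACDeriv θ (fun x => pruferField s l x (θ x)) 0 Real.pi

theorem exists_isPruferAngle {s : ℝ → ℝ}
    (hs : MemLp s 2 (volume.restrict (Ioo 0 Real.pi))) (l c : ℝ) :
    ∃ θ : ℝ → ℝ, θ 0 = c ∧ IsPruferAngle s l θ :=
  exists_caratheodory_solution Real.pi_pos.le (intervalIntegrable_pruferLip hs l)
    (pruferLip_nonneg s l)
    (fun _ hθ => intervalIntegrable_pruferField hs l hθ.continuousOn)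
    (pruferField_lipschitz s l) c

namespace IsPruferAngle

variable {s : ℝ → ℝ} {l l' : ℝ} {θ φ : ℝ → ℝ}

theorem continuousOn (h : IsPruferAngle s l θ) : ContinuousOn θ (Icc 0 Real.pi) :=
  HasACDeriv.continuousOn h Real.pi_pos.le

theorem intervalIntegrable_sin_sq (h : IsPruferAngle s l θ) (c : ℝ) :
    IntervalIntegrable (fun x => c * Real.sin (θ x) ^ 2) volume 0 Real.pi := by
  refine ContinuousOn.intervalIntegrable ?_
  rw [uIcc_of_le Real.pi_pos.le]
  exact continuousOn_const.mul ((Real.continuous_sin.comp_continuousOn h.continuousOn).pow 2)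

/-- The Prüfer angle crosses the multiples of `π` upwards. -/
theorem lt_of_le_int_mul_pi (hs : MemLp s 2 (volume.restrict (Ioo 0 Real.pi)))
    (h : IsPruferAngle s l θ) {k : ℤ} {x y : ℝ} (hx : 0 ≤ x) (hxy : x < y) (hy : y ≤ Real.pi)
    (hk : k * Real.pi ≤ θ x) : k * Real.pi < θ y := by
  have hsub : uIcc x y ⊆ uIcc 0 Real.pi := by
    rw [uIcc_of_le hxy.le, uIcc_of_le Real.pi_pos.le]; exact Icc_subset_Icc hx hy
  have hD := (h.mono hx hxy.le hy).sub (.const (k * Real.pi) x y)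
  -- At a multiple of π the field equals 1 for every s and l, so θ - kπ satisfies the comparison
  -- hypothesis with forcing 1; vanishing at y would force 1 = 0 almost everywhere on (x, y).
  obtain ⟨h1, h2⟩ := nonneg_of_comparison (g := fun _ => 1) (L := pruferLip s l) hxy.le hD
    intervalIntegrable_const ((intervalIntegrable_pruferLip hs l).mono_set hsub)
    (.of_forall fun t _ => by
      have := pruferField_lipschitz s l t (θ t) (k * Real.pi)
      rw [pruferField_of_sin_eq_zero s l t (Real.sin_int_mul_pi k)] at this
      rwa [sub_zero])
    (sub_nonneg.2 hk) (.of_forall fun _ _ => zero_le_one) (right_mem_Icc.2 hxy.le)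
  refine lt_of_le_of_ne (sub_nonneg.1 h1) fun h3 => ?_
  have h4 := h2 (sub_eq_zero.2 h3.symm)
  simp only [one_ne_zero, imp_false] at h4
  have h5 : volume (Ioo x y) = 0 := by
    rw [measure_eq_zero_iff_ae_notMem]; exact h4
  rw [Real.volume_Ioo] at h5
  simp only [ENNReal.ofReal_eq_zero] at h5
  linarith

theorem mono (hs : MemLp s 2 (volume.restrict (Ioo 0 Real.pi)))
    (h : IsPruferAngle s l θ) (h' : IsPruferAngle s l' φ) (hl : l ≤ l') (h0 : θ 0 ≤ φ 0) :
    θ Real.pi ≤ φ Real.pi :=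
  sub_nonneg.1 (nonneg_of_comparison Real.pi_pos.le (h'.sub h)
    (h'.intervalIntegrable_sin_sq (l' - l)) (intervalIntegrable_pruferLip hs l)
    (.of_forall fun t _ => pruferField_sub_comparison s l l' t (φ t) (θ t)) (sub_nonneg.2 h0)
    (.of_forall fun _ _ => mul_nonneg (sub_nonneg.2 hl) (sq_nonneg _))
    (right_mem_Icc.2 Real.pi_pos.le)).1

/-- Equality at π would make the forcing (l' - l) sin² φ vanish, so sin φ ≡ 0. Then φ' = 1 and the
derivative of sin φ is cos φ, which must also vanish: impossible. -/
theorem strict_mono (hs : MemLp s 2 (volume.restrict (Ioo 0 Real.pi)))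
    (h : IsPruferAngle s l θ) (h' : IsPruferAngle s l' φ) (hl : l < l') (h0 : θ 0 ≤ φ 0) :
    θ Real.pi < φ Real.pi := by
  refine lt_of_le_of_ne (h.mono hs h' hl.le h0) fun heq => ?_
  have h1 := (nonneg_of_comparison Real.pi_pos.le (h'.sub h)
    (h'.intervalIntegrable_sin_sq (l' - l)) (intervalIntegrable_pruferLip hs l)
    (.of_forall fun t _ => pruferField_sub_comparison s l l' t (φ t) (θ t)) (sub_nonneg.2 h0)
    (.of_forall fun _ _ => mul_nonneg (sub_nonneg.2 hl.le) (sq_nonneg _))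
    (right_mem_Icc.2 Real.pi_pos.le)).2 (sub_eq_zero.2 heq.symm)
  have h2 : ∀ x ∈ Icc 0 Real.pi, Real.sin (φ x) = 0 :=
    eq_zero_of_ae_eq_zero Real.pi_pos
      (Real.continuous_sin.comp_continuousOn h'.continuousOn) (by
        filter_upwards [h1] with t ht ht'
        simpa [(sub_pos.2 hl).ne'] using ht ht')
  have h3 := (HasACDeriv.comp_contDiff Real.contDiff_sin Real.hasDerivAt_sin
    h').deriv_eq_zero_of_const fun x hx => h2 x (Ioo_subset_Icc_self hx)
  have h5 : volume (Ioo 0 Real.pi) = 0 := by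
    rw [measure_eq_zero_iff_ae_notMem]
    filter_upwards [h3] with t ht ht'
    have h6 := h2 t (Ioo_subset_Icc_self ht')
    have h7 := ht ht'
    rw [pruferField_of_sin_eq_zero _ _ _ h6, one_smul] at h7
    have := Real.sin_sq_add_cos_sq (φ t)
    rw [h6, h7] at this
    norm_num at this
  rw [Real.volume_Ioo] at h5
  simp only [ENNReal.ofReal_eq_zero] at h5
  linarith [Real.pi_pos]

theorem abs_sub_le (hs : MemLp s 2 (volume.restrict (Ioo 0 Real.pi)))
    (h : IsPruferAngle s l θ) (h' : IsPruferAngle s l' φ) :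
    |φ Real.pi - θ Real.pi| ≤ Real.exp (∫ t in (0 : ℝ)..Real.pi, |pruferLip s l t|) *
      (|φ 0 - θ 0| + |l' - l| * Real.exp (∫ t in (0 : ℝ)..Real.pi, |pruferLip s l t|) *
        (Real.pi - 0)) :=
  abs_le_of_comparison Real.pi_pos.le (h'.sub h)
    (h'.intervalIntegrable_sin_sq (l' - l)) (intervalIntegrable_pruferLip hs l)
    (.of_forall fun t _ => pruferField_sub_comparison s l l' t (φ t) (θ t))
    (.of_forall fun t _ => by
      rw [abs_mul, abs_of_nonneg (sq_nonneg (Real.sin (φ t)))]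
      exact mul_le_of_le_one_right (abs_nonneg _) (Real.sin_sq_le_one _))

end IsPruferAngle

/-! ### The Prüfer angle for large negative and large positive λ. -/

theorem exists_truncation_integral_le {q : ℝ → ℝ} {a b : ℝ}
    (hq : IntervalIntegrable q volume a b) {ε : ℝ} (hε : 0 < ε) :
    ∃ N : ℕ, IntervalIntegrable (fun x => max (q x - N) 0) volume a b ∧
      ∫ x in a..b, max (q x - N) 0 ≤ ε := by
  have hint : ∀ N : ℕ, IntervalIntegrable (fun x => max (q x - N) 0) volume a b := by
    intro N
    have := hq.sub (intervalIntegrable_const (μ := volume) (a := a) (b := b) (c := (N : ℝ)))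
    exact ⟨this.1.pos_part, this.2.pos_part⟩
  have ht : Filter.Tendsto (fun N : ℕ => ∫ x in a..b, max (q x - N) 0) Filter.atTop
      (nhds (∫ x in a..b, (0 : ℝ))) := by
    refine intervalIntegral.tendsto_integral_filter_of_dominated_convergence (fun x => |q x|)
      (.of_forall fun N => ?_) (.of_forall fun N => .of_forall fun x _ => ?_) hq.abs
      (.of_forall fun x _ => ?_)
    · exact (intervalIntegrable_iff.1 (hint N)).aestronglyMeasurable
    · rw [Real.norm_eq_abs, abs_of_nonneg (le_max_right _ _)]
      exact max_le (by linarith [le_abs_self (q x), Nat.cast_nonneg (α := ℝ) N]) (abs_nonneg _)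
    · refine tendsto_const_nhds.congr' ?_
      obtain ⟨M, hM⟩ := exists_nat_ge (q x)
      filter_upwards [Filter.eventually_ge_atTop M] with N hN
      have : (M : ℝ) ≤ N := by exact_mod_cast hN
      rw [max_eq_right (by linarith)]
  simp only [intervalIntegral.integral_zero] at ht
  obtain ⟨N, hN⟩ := (ht.eventually (gt_mem_nhds hε)).exists
  exact ⟨N, hint N, hN.le⟩

/-- A supersolution ψ descends from α + ε to at most 2ε while staying in [ε, π - ε], where sin ψ ≥
sin ε, so a very negative l dominates the field along it. As s² may be unbounded, its excess over N
is put into ψ' instead; its integral is small. -/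
theorem exists_pruferAngle_lt {s : ℝ → ℝ}
    (hs : MemLp s 2 (volume.restrict (Ioo 0 Real.pi))) {α η : ℝ} (hα0 : 0 ≤ α)
    (hα : α < Real.pi) (hη : 0 < η) :
    ∃ l₀ : ℝ, ∀ l ≤ l₀, ∀ θ : ℝ → ℝ, IsPruferAngle s l θ → θ 0 ≤ α → θ Real.pi < η := by
  have hπ := Real.pi_pos
  obtain ⟨ε, hε, hεη, hεα⟩ : ∃ ε : ℝ, 0 < ε ∧ 2 * ε < η ∧ 3 * ε ≤ Real.pi - α := by
    refine ⟨min (η / 3) ((Real.pi - α) / 3), lt_min (by linarith) (by linarith), ?_, ?_⟩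
    · linarith [min_le_left (η / 3) ((Real.pi - α) / 3)]
    · linarith [min_le_right (η / 3) ((Real.pi - α) / 3)]
  have hsq := intervalIntegrable_sq_of_memLp hs
  obtain ⟨N, hNi, hN⟩ := exists_truncation_integral_le hsq (half_pos hε)
  have hsε : 0 < Real.sin ε := Real.sin_pos_of_pos_of_lt_pi hε (by linarith)
  -- The field without the l term is at most 2 + 2s², and the slope of ψ is at least 2(s² - N) - 1;
  -- hence l sin² ε ≤ -(2N + 3) suffices.
  refine ⟨-((2 * N + 3) / Real.sin ε ^ 2), fun l hl θ hθ hθ0 => ?_⟩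
  have hi2 : IntervalIntegrable (fun x => 2 * max (s x ^ 2 - N) 0 - α / Real.pi)
      volume 0 Real.pi := (hNi.const_mul 2).sub intervalIntegrable_const
  set ψ : ℝ → ℝ := fun x => (α + ε) + ∫ t in (0 : ℝ)..x, (2 * max (s t ^ 2 - N) 0 - α / Real.pi)
    with hψ
  have hψd : HasACDeriv ψ (fun x => 2 * max (s x ^ 2 - N) 0 - α / Real.pi) 0 Real.pi :=
    ((HasACDeriv.const _ _ _).add (.of_integral hi2 hπ.le)).congr_deriv
      (.of_forall fun x _ => zero_add _)
  have hψe : ∀ x ∈ Icc 0 Real.pi, α + ε - α / Real.pi * x ≤ ψ x ∧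
      ψ x ≤ α + ε - α / Real.pi * x + ε := by
    intro x hx
    have hNx : IntervalIntegrable (fun x => max (s x ^ 2 - N) 0) volume 0 x :=
      hNi.mono_set (by
        rw [uIcc_of_le hx.1, uIcc_of_le hπ.le]; exact Icc_subset_Icc_right hx.2)
    have e : ψ x = α + ε + (2 * (∫ t in (0 : ℝ)..x, max (s t ^ 2 - N) 0) - α / Real.pi * x) := by
      simp only [hψ]
      rw [intervalIntegral.integral_sub (hNx.const_mul 2) intervalIntegrable_const,
        intervalIntegral.integral_const_mul, intervalIntegral.integral_const, smul_eq_mul,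
        sub_zero, mul_comm x]
    have h0 : 0 ≤ ∫ t in (0 : ℝ)..x, max (s t ^ 2 - N) 0 :=
      intervalIntegral.integral_nonneg hx.1 fun _ _ => le_max_right _ _
    have h1 : ∫ t in (0 : ℝ)..x, max (s t ^ 2 - N) 0 ≤
        ∫ t in (0 : ℝ)..Real.pi, max (s t ^ 2 - N) 0 :=
      intervalIntegral.integral_mono_interval le_rfl hx.1 hx.2
        (.of_forall fun _ => le_max_right _ _) hNi
    rw [e]
    constructor <;> linarith
  have hαπ : α / Real.pi ≤ 1 := (div_le_one hπ).2 hα.le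
  have hαπ0 : 0 ≤ α / Real.pi := by positivity
  have hαe : α / Real.pi * Real.pi = α := by field_simp
  have hsin : ∀ x ∈ Icc 0 Real.pi, Real.sin ε ≤ Real.sin (ψ x) := by
    intro x hx
    obtain ⟨h1, h2⟩ := hψe x hx
    have h3 : α / Real.pi * x ≤ α := by
      calc α / Real.pi * x ≤ α / Real.pi * Real.pi := by gcongr; exact hx.2
        _ = α := hαe
    have h4 : 0 ≤ α / Real.pi * x := mul_nonneg hαπ0 hx.1
    rcases le_total (ψ x) (Real.pi / 2) with h | h
    · exact Real.sin_le_sin_of_le_of_le_pi_div_two (by linarith) h (by linarith)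
    · rw [← Real.sin_pi_sub (ψ x)]
      exact Real.sin_le_sin_of_le_of_le_pi_div_two (by linarith) (by linarith) (by linarith)
  have hψ0 : ψ 0 = α + ε := by simp [hψ]
  have hl0 : l * Real.sin ε ^ 2 ≤ -(2 * N + 3) := by
    calc l * Real.sin ε ^ 2 ≤ -((2 * N + 3) / Real.sin ε ^ 2) * Real.sin ε ^ 2 := by gcongr
      _ = _ := by field_simp
  have hl1 : l ≤ 0 := hl.trans (by
    have : 0 ≤ (2 * N + 3) / Real.sin ε ^ 2 := by positivity
    linarith)
  have hcmp := (nonneg_of_comparison hπ.le (hψd.sub hθ)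
    (g := fun x => (2 * max (s x ^ 2 - N) 0 - α / Real.pi) - pruferField s l x (ψ x))
    (hi2.sub (intervalIntegrable_pruferField hs l (hψd.continuousOn hπ.le)))
    (intervalIntegrable_pruferLip hs l)
    (.of_forall fun t _ => by
      have := pruferField_lipschitz s l t (ψ t) (θ t)
      convert this using 2
      ring)
    (by rw [hψ0]; linarith)
    (.of_forall fun t ht => by
      have h1 := hsin t (Ioo_subset_Icc_self ht)
      have h2 : l * Real.sin (ψ t) ^ 2 ≤ l * Real.sin ε ^ 2 :=
        mul_le_mul_of_nonpos_left (by gcongr) hl1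
      have h3 : (Real.cos (ψ t) + s t * Real.sin (ψ t)) ^ 2 ≤ 2 + 2 * s t ^ 2 := by
        have := Real.sin_sq_add_cos_sq (ψ t)
        nlinarith [sq_nonneg (Real.cos (ψ t) - s t * Real.sin (ψ t)),
          mul_nonneg (sq_nonneg (s t)) (sq_nonneg (Real.cos (ψ t))), sq_nonneg (Real.sin (ψ t))]
      have h4 := le_max_left (s t ^ 2 - N) 0
      unfold pruferField
      linarith)
    (right_mem_Icc.2 hπ.le)).1
  have h5 := (hψe Real.pi (right_mem_Icc.2 hπ.le)).2
  rw [hαe] at h5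
  linarith

/-- The rescaled Prüfer angle: `tan (pruferScale k t) = k tan t`, with equality at the multiples
of `π / 2`. -/
noncomputable def pruferScale (k t : ℝ) : ℝ :=
  t + Real.arctan ((k - 1) * Real.sin t * Real.cos t / (Real.cos t ^ 2 + k * Real.sin t ^ 2))

theorem cos_sq_add_mul_sin_sq_pos {k : ℝ} (hk : 0 < k) (t : ℝ) :
    0 < Real.cos t ^ 2 + k * Real.sin t ^ 2 := by
  by_cases h : Real.sin t = 0
  · have := Real.sin_sq_add_cos_sq t
    rw [h] at this ⊢
    linarith
  · positivity

theorem contDiff_pruferScale {k : ℝ} (hk : 0 < k) : ContDiff ℝ 1 (pruferScale k) := by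
  unfold pruferScale
  refine contDiff_id.add (Real.contDiff_arctan.comp (ContDiff.div ?_ ?_ fun t =>
    (cos_sq_add_mul_sin_sq_pos hk t).ne'))
  · exact (contDiff_const.mul Real.contDiff_sin).mul Real.contDiff_cos
  · exact (Real.contDiff_cos.pow 2).add (contDiff_const.mul (Real.contDiff_sin.pow 2))

theorem hasDerivAt_pruferScale {k : ℝ} (hk : 0 < k) (t : ℝ) :
    HasDerivAt (pruferScale k) (k / (Real.cos t ^ 2 + k ^ 2 * Real.sin t ^ 2)) t := by
  have hq := (cos_sq_add_mul_sin_sq_pos hk t).ne'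
  have hp := (cos_sq_add_mul_sin_sq_pos (pow_pos hk 2) t).ne'
  have hs := Real.hasDerivAt_sin t
  have hc := Real.hasDerivAt_cos t
  have h := (hasDerivAt_id t).add (((hs.const_mul (k - 1)).mul hc).div
    ((hc.pow 2).add ((hs.pow 2).const_mul k)) hq).arctan
  refine HasDerivAt.congr_deriv (f := pruferScale k) h ?_
  change 1 + 1 / (1 + ((k - 1) * Real.sin t * Real.cos t /
      (Real.cos t ^ 2 + k * Real.sin t ^ 2)) ^ 2) *
    ((((k - 1) * Real.cos t * Real.cos t + (k - 1) * Real.sin t * -Real.sin t) *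
        (Real.cos t ^ 2 + k * Real.sin t ^ 2) - (k - 1) * Real.sin t * Real.cos t *
          (((2 : ℕ) : ℝ) * Real.cos t ^ (2 - 1) * -Real.sin t +
            k * (((2 : ℕ) : ℝ) * Real.sin t ^ (2 - 1) * Real.cos t))) /
      (Real.cos t ^ 2 + k * Real.sin t ^ 2) ^ 2) = _
  have h1 := Real.sin_sq_add_cos_sq t
  clear h hs hc
  generalize Real.sin t = x at *
  generalize Real.cos t = y at *
  -- The squared modulus of (cos t + i k sin t)(cos t - i sin t), whose argument is the arctangent
  -- in `pruferScale`.
  have hr : (y ^ 2 + k * x ^ 2) ^ 2 + ((k - 1) * x * y) ^ 2 = y ^ 2 + k ^ 2 * x ^ 2 := by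
    linear_combination (y ^ 2 + k ^ 2 * x ^ 2) * h1
  have hr' : 1 + ((k - 1) * x * y / (y ^ 2 + k * x ^ 2)) ^ 2 =
      (y ^ 2 + k ^ 2 * x ^ 2) / (y ^ 2 + k * x ^ 2) ^ 2 := by
    rw [← hr]; field_simp
  have hcancel : ∀ p n a : ℝ, a ≠ 0 → a / p * (n / a) = n / p := fun p n a ha => by field_simp
  rw [hr', one_div_div, hcancel _ _ _ (pow_ne_zero 2 hq), eq_div_iff hp, add_mul,
    div_mul_cancel₀ _ hp]
  push_cast
  linear_combination (k + (k - 1) * (y ^ 2 - k * x ^ 2)) * h1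

theorem abs_pruferScale_sub_lt (k t : ℝ) : |pruferScale k t - t| < Real.pi / 2 := by
  rw [pruferScale, add_sub_cancel_left, abs_lt]
  exact ⟨Real.neg_pi_div_two_lt_arctan _, Real.arctan_lt_pi_div_two _⟩

/-- For λ = k² the rescaled angle has derivative at least k - |s|: the terms cos² θ + k² sin² θ
cancel the denominator, the cross term costs at most |s|, and the s² term is nonnegative. Rescaling
moves each endpoint value by less than π / 2, whence the final -π. -/
theorem IsPruferAngle.lower_bound {s : ℝ → ℝ}
    (hs : MemLp s 2 (volume.restrict (Ioo 0 Real.pi))) {k : ℝ} (hk : 0 < k) {θ : ℝ → ℝ}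
    (hθ : IsPruferAngle s (k ^ 2) θ) :
    θ 0 + k * Real.pi - (∫ x in (0 : ℝ)..Real.pi, |s x|) - Real.pi ≤ θ Real.pi := by
  have hπ := Real.pi_pos
  have hΦ := HasACDeriv.comp_contDiff (contDiff_pruferScale hk) (hasDerivAt_pruferScale hk) hθ
  have hs1 := (intervalIntegrable_of_memLp hs).abs
  have hlow := HasACDeriv.of_integral ((intervalIntegrable_const (c := k)).sub hs1) hπ.le
  have hmono := (hΦ.sub hlow).monotoneOn (.of_forall fun x _ => by
    have hp := cos_sq_add_mul_sin_sq_pos (pow_pos hk 2) (θ x)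
    rw [sub_nonneg, smul_eq_mul, mul_div_assoc', le_div_iff₀ hp]
    unfold pruferField
    generalize Real.sin (θ x) = p at *
    generalize Real.cos (θ x) = q at *
    have h1 : -(|s x| * (q ^ 2 + k ^ 2 * p ^ 2)) ≤ 2 * s x * (q * (k * p)) := by
      have h2 : |2 * (q * (k * p))| ≤ q ^ 2 + k ^ 2 * p ^ 2 := by
        rw [abs_le]
        constructor <;> nlinarith [sq_nonneg (q + k * p), sq_nonneg (q - k * p)]
      have h3 : |2 * s x * (q * (k * p))| ≤ |s x| * (q ^ 2 + k ^ 2 * p ^ 2) := by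
        rw [show 2 * s x * (q * (k * p)) = s x * (2 * (q * (k * p))) by ring, abs_mul]
        gcongr
      exact (abs_le.1 h3).1
    nlinarith [mul_nonneg hk.le (sq_nonneg (s x * p))])
  have h1 := hmono (left_mem_Icc.2 hπ.le) (right_mem_Icc.2 hπ.le) hπ.le
  simp only [intervalIntegral.integral_same, sub_zero] at h1
  rw [intervalIntegral.integral_sub intervalIntegrable_const hs1,
    intervalIntegral.integral_const, smul_eq_mul, sub_zero] at h1
  have h2 := abs_lt.1 (abs_pruferScale_sub_lt k (θ 0))
  have h3 := abs_lt.1 (abs_pruferScale_sub_lt k (θ Real.pi))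
  linarith [h2.1, h3.2]

/-! ### Boundary coefficients as angles. -/

namespace RationalHN

/-- The value of the function at a real point. -/
noncomputable def evalReal (f : RationalHN) (t : ℝ) : ℝ :=
  f.h₀ * t + f.h + ∑ k, f.δ k / (f.pole k - t)

theorem eval_ofReal (f : RationalHN) (t : ℝ) : f.eval t = (f.evalReal t : ℂ) := by
  simp [eval, evalReal]

theorem isPole_ofReal (f : RationalHN) (t : ℝ) : f.IsPole t ↔ ∃ k, f.pole k = t := by
  simp [IsPole]

end RationalHN

namespace BoundaryCoeff

open Classical in
/-- A continuous nondecreasing choice of the angle whose cotangent is minus the coefficient. -/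
noncomputable def angle : BoundaryCoeff → ℝ → ℝ
  | infty, _ => 0
  | rational f, t => (if ∃ k, f.pole k = t then 0 else Real.pi / 2 + Real.arctan (f.evalReal t)) +
      ((rational f).poleCount t : ℝ) * Real.pi

theorem poleCount_rational_congr {f : RationalHN} {t u : ℝ}
    (h : ∀ k, f.pole k ≤ t ↔ f.pole k ≤ u) :
    (rational f).poleCount t = (rational f).poleCount u := by
  simp [poleCount, h]

theorem angle_rational_of_pole {f : RationalHN} {t : ℝ} (h : ∃ k, f.pole k = t) :
    (rational f).angle t = ((rational f).poleCount t : ℝ) * Real.pi := by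
  simp [angle, h]

theorem angle_rational_of_not_pole {f : RationalHN} {t : ℝ} (h : ¬ ∃ k, f.pole k = t) :
    (rational f).angle t = Real.pi / 2 + Real.arctan (f.evalReal t) +
      ((rational f).poleCount t : ℝ) * Real.pi := by
  rw [angle, if_neg h]

theorem poleCount_mul_pi_le_angle (f : BoundaryCoeff) (t : ℝ) :
    (f.poleCount t : ℝ) * Real.pi ≤ f.angle t := by
  match f with
  | infty => simp [angle, poleCount]
  | rational f =>
    by_cases h : ∃ k, f.pole k = t
    · rw [angle_rational_of_pole h]
    · rw [angle_rational_of_not_pole h]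
      linarith [Real.neg_pi_div_two_lt_arctan (f.evalReal t)]

theorem angle_lt (f : BoundaryCoeff) (t : ℝ) :
    f.angle t < ((f.poleCount t : ℝ) + 1) * Real.pi := by
  have := Real.pi_pos
  match f with
  | infty => simpa [angle, poleCount]
  | rational f =>
    by_cases h : ∃ k, f.pole k = t
    · rw [angle_rational_of_pole h]
      linarith
    · rw [angle_rational_of_not_pole h]
      linarith [Real.arctan_lt_pi_div_two (f.evalReal t)]

theorem angle_nonneg (f : BoundaryCoeff) (t : ℝ) : 0 ≤ f.angle t :=
  le_trans (by positivity) (f.poleCount_mul_pi_le_angle t)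

/-- If the pole count grows, the bounds Ππ ≤ angle < (Π + 1)π already decide. Otherwise (t, u]
contains no pole, and every term of f is nondecreasing between poles. -/
theorem monotone_angle (f : BoundaryCoeff) : Monotone f.angle := by
  match f with
  | infty => exact fun _ _ _ => le_rfl
  | rational f =>
    intro t u htu
    have hsub : (Finset.univ.filter fun k => f.pole k ≤ t) ⊆
        Finset.univ.filter fun k => f.pole k ≤ u :=
      Finset.monotone_filter_right _ fun k _ hk => hk.trans htu
    rcases (Finset.card_le_card hsub).lt_or_eq with h | h
    · have h1 : (((rational f).poleCount t : ℝ) + 1) ≤ (rational f).poleCount u := by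
        have : (rational f).poleCount t + 1 ≤ (rational f).poleCount u := by
          unfold poleCount
          convert Nat.succ_le_of_lt h
        exact_mod_cast this
      exact ((angle_lt _ t).le.trans (by gcongr)).trans (poleCount_mul_pi_le_angle _ u)
    · have heq := Finset.eq_of_subset_of_card_le hsub h.ge
      have hk : ∀ k, f.pole k ≤ u → f.pole k ≤ t := fun k hk => by
        have : k ∈ Finset.univ.filter fun k => f.pole k ≤ t := by rw [heq]; simpa using hk
        simpa using this
      have hc : (rational f).poleCount t = (rational f).poleCount u := by
        unfold poleCount
        convert h
      rcases htu.eq_or_lt with rfl | htu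
      · exact le_rfl
      have hu : ¬ ∃ k, f.pole k = u := fun ⟨k, h1⟩ => by linarith [hk k h1.le]
      by_cases ht : ∃ k, f.pole k = t
      · rw [angle_rational_of_pole ht, hc]
        exact poleCount_mul_pi_le_angle _ u
      · rw [angle_rational_of_not_pole ht, angle_rational_of_not_pole hu, hc]
        gcongr
        unfold RationalHN.evalReal
        refine add_le_add (add_le_add_left (mul_le_mul_of_nonneg_left htu.le f.h₀_nonneg) _)
          (Finset.sum_le_sum fun k _ => ?_)
        rcases le_or_gt (f.pole k) u with h1 | h1
        · have h2 : f.pole k < t := lt_of_le_of_ne (hk k h1) fun h => ht ⟨k, h⟩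
          rw [← neg_sub t, ← neg_sub u, div_neg, div_neg, neg_le_neg_iff]
          exact div_le_div_of_nonneg_left (f.δ_pos k).le (by linarith) (by linarith)
        · exact div_le_div_of_nonneg_left (f.δ_pos k).le (by linarith) (by linarith)

theorem continuous_angle (f : BoundaryCoeff) : Continuous f.angle := by
  match f with
  | infty => exact continuous_const
  | rational f =>
    refine continuous_iff_continuousAt.2 fun t => ?_
    have hev : ∀ᶠ x in nhds t, ∀ k, f.pole k ≠ t →
        f.pole k ≠ x ∧ (f.pole k ≤ x ↔ f.pole k ≤ t) := by
      refine Filter.eventually_all.2 fun k => ?_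
      rcases lt_trichotomy (f.pole k) t with h | h | h
      · filter_upwards [lt_mem_nhds h] with x hx _
        exact ⟨hx.ne, iff_of_true hx.le h.le⟩
      · exact .of_forall fun x hx => absurd h hx
      · filter_upwards [gt_mem_nhds h] with x hx _
        exact ⟨hx.ne', iff_of_false hx.not_ge h.not_ge⟩
    by_cases ht : ∃ k, f.pole k = t
    · obtain ⟨k₀, rfl⟩ := ht
      set t := f.pole k₀ with htdef
      have hne : ∀ k, k ≠ k₀ → f.pole k ≠ t := fun k hk h => hk (f.pole_strictMono.injective h)
      -- Split off the polar term: f = δ / (t - x) + R = 1 / w with w = (t - x) / (δ + (t - x) R)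
      -- continuous at the pole. The reflection of the arctangent under w ↦ 1 / w, together with the
      -- jump of the pole count, gives angle = Ππ - arctan w on both sides, Π being the count at t.
      set R : ℝ → ℝ := fun x => f.h₀ * x + f.h + ∑ k ∈ Finset.univ.erase k₀, f.δ k / (f.pole k - x)
        with hR
      have hRc : ContinuousAt R t := by
        refine ContinuousAt.add (by fun_prop) (tendsto_finsetSum _ fun k hk => ?_)
        exact ContinuousAt.div continuousAt_const (by fun_prop)
          (sub_ne_zero.2 (hne k (Finset.ne_of_mem_erase hk)))
      have hden : ContinuousAt (fun x => f.δ k₀ + (t - x) * R x) t := by fun_prop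
      have hpos : 0 < f.δ k₀ + (t - t) * R t := by simpa using f.δ_pos k₀
      have hq : ContinuousAt (fun x => (t - x) / (f.δ k₀ + (t - x) * R x)) t :=
        ContinuousAt.div (by fun_prop) hden hpos.ne'
      have hcont : ContinuousAt (fun x => ((rational f).poleCount t : ℝ) * Real.pi -
          Real.arctan ((t - x) / (f.δ k₀ + (t - x) * R x))) t :=
        continuousAt_const.sub (Real.continuous_arctan.continuousAt.comp hq)
      refine hcont.congr ?_
      filter_upwards [hev, hden.eventually (lt_mem_nhds hpos)] with x hx hx'
      rcases eq_or_ne x t with rfl | hxt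
      · rw [angle_rational_of_pole ⟨k₀, htdef.symm⟩]
        simp
      have hnp : ¬ ∃ k, f.pole k = x := by
        rintro ⟨k, hk⟩
        by_cases h : k = k₀
        · exact hxt (by rw [← hk, h])
        · exact (hx k (hne k h)).1 hk
      have hE : f.evalReal x = ((t - x) / (f.δ k₀ + (t - x) * R x))⁻¹ := by
        have h1 : t - x ≠ 0 := sub_ne_zero.2 hxt.symm
        rw [inv_div, add_div, mul_div_cancel_left₀ _ h1, hR, RationalHN.evalReal,
          ← Finset.add_sum_erase _ _ (Finset.mem_univ k₀)]
        ring
      rw [angle_rational_of_not_pole hnp, hE]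
      rcases hxt.lt_or_gt with h | h
      · have hc : (rational f).poleCount t = (rational f).poleCount x + 1 := by
          have hk₀ : k₀ ∉ Finset.univ.filter fun k => f.pole k ≤ x := by
            simpa using h
          unfold poleCount
          rw [← Finset.card_insert_of_notMem (by convert hk₀)]
          refine congrArg Finset.card (Finset.ext fun k => ?_)
          by_cases hk : k = k₀
          · simp [hk, htdef]
          · simpa [hk] using (hx k (hne k hk)).2.symm
        rw [Real.arctan_inv_of_pos (div_pos (by linarith) hx'), hc]
        push_cast
        ring
      · have hc : (rational f).poleCount t = (rational f).poleCount x := by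
          refine poleCount_rational_congr fun k => ?_
          by_cases hk : k = k₀
          · rw [hk, ← htdef]
            exact iff_of_true le_rfl h.le
          · exact (hx k (hne k hk)).2.symm
        rw [Real.arctan_inv_of_neg (div_neg_of_neg_of_pos (by linarith) hx'), hc]
        ring
    · have hne : ∀ k, f.pole k ≠ t := fun k h => ht ⟨k, h⟩
      have hEc : ContinuousAt f.evalReal t := by
        unfold RationalHN.evalReal
        refine ContinuousAt.add (by fun_prop) (tendsto_finsetSum _ fun k _ => ?_)
        exact ContinuousAt.div continuousAt_const (by fun_prop) (sub_ne_zero.2 (hne k))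
      have hcont : ContinuousAt (fun x => Real.pi / 2 + Real.arctan (f.evalReal x) +
          ((rational f).poleCount t : ℝ) * Real.pi) t :=
        (continuousAt_const.add (Real.continuous_arctan.continuousAt.comp hEc)).add
          continuousAt_const
      refine hcont.congr ?_
      filter_upwards [hev] with x hx
      rw [angle_rational_of_not_pole fun ⟨k, hk⟩ => (hx k (hne k)).1 hk]
      rw [poleCount_rational_congr fun k => (hx k (hne k)).2]

theorem exists_angle_lt_pi (f : BoundaryCoeff) : ∃ t, f.angle t < Real.pi := by
  match f with
  | infty => exact ⟨0, Real.pi_pos⟩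
  | rational f =>
    obtain ⟨m, hm⟩ := (Set.finite_range f.pole).bddBelow
    refine ⟨m - 1, ?_⟩
    have h0 : (rational f).poleCount (m - 1) = 0 := by
      unfold poleCount
      rw [Finset.card_eq_zero, Finset.filter_eq_empty_iff]
      intro k _ hk
      linarith [hm (mem_range_self k)]
    simpa [h0] using angle_lt (rational f) (m - 1)

/-- The boundary condition at a real point in terms of the angle. -/
theorem ratio_ofReal_iff (f : BoundaryCoeff) (t : ℝ) (a b : ℂ) :
    f.Ratio t a b ↔
      b * (Real.sin (f.angle t) : ℂ) + a * (Real.cos (f.angle t) : ℂ) = 0 := by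
  match f with
  | infty => simp [Ratio, angle]
  | rational f =>
    have hm : ((-1 : ℝ) ^ (rational f).poleCount t) ≠ 0 := pow_ne_zero _ (by norm_num)
    simp only [Ratio, RationalHN.isPole_ofReal]
    by_cases h : ∃ k, f.pole k = t
    · rw [angle_rational_of_pole h, Real.sin_nat_mul_pi, Real.cos_nat_mul_pi]
      simp [h]
    · rw [angle_rational_of_not_pole h, Real.sin_add_nat_mul_pi, Real.cos_add_nat_mul_pi,
        add_comm (Real.pi / 2), Real.sin_add_pi_div_two, Real.cos_add_pi_div_two]
      have hS : Real.sin (Real.arctan (f.evalReal t)) =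
          f.evalReal t * Real.cos (Real.arctan (f.evalReal t)) := by
        rw [Real.sin_arctan, Real.cos_arctan]; ring
      have hC := (Real.cos_arctan_pos (f.evalReal t)).ne'
      rw [hS, RationalHN.eval_ofReal]
      generalize Real.cos (Real.arctan (f.evalReal t)) = C at *
      generalize ((-1 : ℝ) ^ (rational f).poleCount t) = m at *
      have hmC : ((m * C : ℝ) : ℂ) ≠ 0 := Complex.ofReal_ne_zero.2 (mul_ne_zero hm hC)
      have e : b * ((m * C : ℝ) : ℂ) + a * ((m * -(f.evalReal t * C) : ℝ) : ℂ) =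
          (b - f.evalReal t * a) * ((m * C : ℝ) : ℂ) := by
        push_cast; ring
      rw [e, mul_eq_zero, or_iff_left hmC, sub_eq_zero]
      simp [h]

/-- The Herglotz property: off the real axis the boundary form has the sign of `im z`. -/
theorem Ratio.exists_im_eq {f : BoundaryCoeff} {z a b : ℂ} (hz : z.im ≠ 0) (h : f.Ratio z a b) :
    ∃ c : ℝ, 0 ≤ c ∧ (b * (starRingEnd ℂ) a).im = c * z.im := by
  match f with
  | infty => exact ⟨0, le_rfl, by rw [show a = 0 from h]; simp⟩
  | rational f =>
    have hnp : ¬ f.IsPole z := by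
      rintro ⟨k, rfl⟩
      exact hz (Complex.ofReal_im _)
    rw [h.2 hnp]
    refine ⟨(f.h₀ + ∑ k, f.δ k / Complex.normSq (f.pole k - z)) * Complex.normSq a,
      mul_nonneg (add_nonneg f.h₀_nonneg (Finset.sum_nonneg fun k _ =>
        div_nonneg (f.δ_pos k).le (Complex.normSq_nonneg _))) (Complex.normSq_nonneg _), ?_⟩
    rw [mul_assoc, Complex.mul_conj, Complex.im_mul_ofReal, mul_right_comm]
    congr 1
    have him : ∀ k, ((f.δ k : ℂ) / ((f.pole k : ℂ) - z)).im =
        f.δ k / Complex.normSq (f.pole k - z) * z.im := fun k => by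
      rw [Complex.div_im]
      simp
      ring
    rw [RationalHN.eval, Complex.add_im, Complex.add_im, Complex.im_ofReal_mul, Complex.ofReal_im,
      add_zero, Complex.im_sum, add_mul, Finset.sum_mul]
    simp only [him]

end BoundaryCoeff

/-! ### From Prüfer angles to solutions and eigenfunctions. -/

theorem IsPruferAngle.exists_solution {s : ℝ → ℝ}
    (hs : MemLp s 2 (volume.restrict (Ioo 0 Real.pi))) {l : ℝ} {θ : ℝ → ℝ}
    (hθ : IsPruferAngle s l θ) :
    ∃ r : ℝ → ℝ, (∀ x, 0 < r x) ∧
      HasACDeriv (fun x => r x * Real.sin (θ x))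
        (fun x => s x * (r x * Real.sin (θ x)) + r x * Real.cos (θ x)) 0 Real.pi ∧
      HasACDeriv (fun x => r x * Real.cos (θ x))
        (fun x => -s x * (r x * Real.cos (θ x)) - (s x ^ 2 + l) * (r x * Real.sin (θ x)))
        0 Real.pi := by
  -- The logarithmic derivative r' / r dictated by y = r sin θ, u = r cos θ.
  set p : ℝ → ℝ := fun x => s x * (Real.sin (θ x) ^ 2 - Real.cos (θ x) ^ 2) +
    (1 - l) * (Real.sin (θ x) * Real.cos (θ x)) - s x ^ 2 * (Real.sin (θ x) * Real.cos (θ x))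
    with hp
  have hc := hθ.continuousOn
  rw [← uIcc_of_le Real.pi_pos.le] at hc
  have h1 : ContinuousOn (fun x => Real.sin (θ x)) (uIcc 0 Real.pi) :=
    Real.continuous_sin.comp_continuousOn hc
  have h2 : ContinuousOn (fun x => Real.cos (θ x)) (uIcc 0 Real.pi) :=
    Real.continuous_cos.comp_continuousOn hc
  have hpi : IntervalIntegrable p volume 0 Real.pi :=
    (((intervalIntegrable_of_memLp hs).mul_continuousOn ((h1.pow 2).sub (h2.pow 2))).add
      (continuousOn_const.mul (h1.mul h2)).intervalIntegrable).sub
      ((intervalIntegrable_sq_of_memLp hs).mul_continuousOn (h1.mul h2))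
  have hr := (HasACDeriv.of_integral hpi Real.pi_pos.le).comp_contDiff (φ := Real.exp)
    Real.contDiff_exp Real.hasDerivAt_exp
  have hsin := HasACDeriv.comp_contDiff Real.contDiff_sin Real.hasDerivAt_sin hθ
  have hcos := HasACDeriv.comp_contDiff Real.contDiff_cos Real.hasDerivAt_cos hθ
  refine ⟨fun x => Real.exp (∫ t in (0 : ℝ)..x, p t), fun x => Real.exp_pos _,
    (hr.mul hsin).congr_deriv (.of_forall fun x _ => ?_),
    (hr.mul hcos).congr_deriv (.of_forall fun x _ => ?_)⟩
  all_goals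
    simp only [smul_eq_mul, hp, pruferField_eq]
    generalize Real.exp _ = e
    have hsc := Real.sin_sq_add_cos_sq (θ x)
    generalize Real.sin (θ x) = S at *
    generalize Real.cos (θ x) = C at *
  · linear_combination (e * (S * s x + C)) * hsc
  · linear_combination (-e * (C * s x + (s x ^ 2 + l) * S)) * hsc

/-- The two first order equations satisfied by a solution and its quasi-derivative. -/
structure IsACSolution (s : ℝ → ℝ) (z : ℂ) (y u : ℝ → ℂ) : Prop where
  fst : HasACDeriv y (fun x => s x * y x + u x) 0 Real.pi
  snd : HasACDeriv u (fun x => -s x * u x - (s x ^ 2 + z) * y x) 0 Real.pi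

theorem isSolution_iff {s : ℝ → ℝ} {z : ℂ} {y u : ℝ → ℂ} :
    IsSolution s z y u ↔ IsACSolution s z y u := by
  constructor
  · rintro ⟨hy, hu, h⟩
    rw [ae_restrict_iff' measurableSet_Ioo] at h
    refine ⟨⟨hy, ?_⟩, ⟨hu, ?_⟩⟩
    · filter_upwards [h] with x hx hx'
      obtain ⟨y', u', h1, h2, h3, h4⟩ := hx hx'
      exact h1.congr_deriv (by linear_combination h3)
    · filter_upwards [h] with x hx hx'
      obtain ⟨y', u', h1, h2, h3, h4⟩ := hx hx'
      exact h2.congr_deriv (by linear_combination -h4)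
  · rintro ⟨hy, hu⟩
    refine ⟨hy.ac, hu.ac, ?_⟩
    rw [ae_restrict_iff' measurableSet_Ioo]
    filter_upwards [hy.deriv, hu.deriv] with x h1 h2 hx
    exact ⟨_, _, h1 hx, h2 hx, by ring, by ring⟩

theorem IsPruferAngle.exists_isACSolution {s : ℝ → ℝ}
    (hs : MemLp s 2 (volume.restrict (Ioo 0 Real.pi))) {l : ℝ} {θ : ℝ → ℝ}
    (hθ : IsPruferAngle s l θ) :
    ∃ r : ℝ → ℝ, (∀ x, 0 < r x) ∧ IsACSolution s l
      (fun x => ((r x * Real.sin (θ x) : ℝ) : ℂ)) (fun x => ((r x * Real.cos (θ x) : ℝ) : ℂ)) := by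
  obtain ⟨r, hr, h1, h2⟩ := hθ.exists_solution hs
  refine ⟨r, hr, (h1.clm_comp Complex.ofRealCLM).congr_deriv (.of_forall fun x _ => ?_),
    (h2.clm_comp Complex.ofRealCLM).congr_deriv (.of_forall fun x _ => ?_)⟩ <;>
  · rw [Complex.ofRealCLM_apply]
    push_cast
    ring

theorem IsACSolution.wronskian {s : ℝ → ℝ} {z : ℂ} {y u y₁ u₁ : ℝ → ℂ}
    (h : IsACSolution s z y u) (h₁ : IsACSolution s z y₁ u₁) {x : ℝ} (hx : x ∈ Icc 0 Real.pi) :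
    y x * u₁ x - u x * y₁ x = y 0 * u₁ 0 - u 0 * y₁ 0 :=
  (((h.fst.mul h₁.snd).sub (h.snd.mul h₁.fst)).congr_deriv
    (g' := fun _ => 0) (.of_forall fun x _ => by ring)).eq_of_deriv_eq_zero Real.pi_pos.le hx

/-- A solution with the same initial direction as a Prüfer solution is a multiple of it. -/
theorem IsACSolution.eq_mul_prufer {s : ℝ → ℝ}
    (hs : MemLp s 2 (volume.restrict (Ioo 0 Real.pi))) {l : ℝ} {y u : ℝ → ℂ}
    (h : IsACSolution s l y u) {r θ : ℝ → ℝ} (hr : ∀ x, 0 < r x)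
    (h₁ : IsACSolution s l
      (fun x => ((r x * Real.sin (θ x) : ℝ) : ℂ)) (fun x => ((r x * Real.cos (θ x) : ℝ) : ℂ)))
    (h0 : y 0 * (Real.cos (θ 0) : ℂ) = u 0 * (Real.sin (θ 0) : ℂ)) :
    ∃ c : ℂ, ∀ x ∈ Icc 0 Real.pi, y x = c * ((r x * Real.sin (θ x) : ℝ) : ℂ) ∧
      u x = c * ((r x * Real.cos (θ x) : ℝ) : ℂ) := by
  -- Shifting the initial angle by π / 2 gives a second, independent solution. Constancy of the
  -- three Wronskians then expresses y by Cramer's rule, so no separate uniqueness theorem is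
  -- needed.
  obtain ⟨φ, hφ0, hφ⟩ := exists_isPruferAngle hs l (θ 0 + Real.pi / 2)
  obtain ⟨r₂, hr₂, h₂⟩ := hφ.exists_isACSolution hs
  have w₁ : ∀ x ∈ Icc 0 Real.pi, _ := fun x hx => h.wronskian h₁ hx
  have w₂ : ∀ x ∈ Icc 0 Real.pi, _ := fun x hx => h.wronskian h₂ hx
  have w₃ : ∀ x ∈ Icc 0 Real.pi, _ := fun x hx => h₁.wronskian h₂ hx
  have e₁ : y 0 * ((r 0 * Real.cos (θ 0) : ℝ) : ℂ) - u 0 * ((r 0 * Real.sin (θ 0) : ℝ) : ℂ)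
      = 0 := by
    push_cast at h0 ⊢
    linear_combination (r 0 : ℂ) * h0
  have e₃ : ((r 0 * Real.sin (θ 0) : ℝ) : ℂ) * ((r₂ 0 * Real.cos (φ 0) : ℝ) : ℂ) -
      ((r 0 * Real.cos (θ 0) : ℝ) : ℂ) * ((r₂ 0 * Real.sin (φ 0) : ℝ) : ℂ) =
      ((-(r 0 * r₂ 0) : ℝ) : ℂ) := by
    rw [hφ0, Real.cos_add_pi_div_two, Real.sin_add_pi_div_two]
    norm_cast
    linear_combination -(r 0 * r₂ 0) * Real.sin_sq_add_cos_sq (θ 0)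
  have hW : ((-(r 0 * r₂ 0) : ℝ) : ℂ) ≠ 0 :=
    Complex.ofReal_ne_zero.2 (neg_ne_zero.2 (mul_pos (hr 0) (hr₂ 0)).ne')
  rw [e₁] at w₁
  rw [e₃] at w₃
  generalize ((-(r 0 * r₂ 0) : ℝ) : ℂ) = W at *
  generalize y 0 * _ - _ = C at w₂
  refine ⟨C / W, fun x hx => ?_⟩
  have a₁ := w₁ x hx
  have a₂ := w₂ x hx
  have a₃ := w₃ x hx
  generalize ((r x * Real.sin (θ x) : ℝ) : ℂ) = A at *
  generalize ((r x * Real.cos (θ x) : ℝ) : ℂ) = B at *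
  generalize ((r₂ x * Real.sin (φ x) : ℝ) : ℂ) = A' at *
  generalize ((r₂ x * Real.cos (φ x) : ℝ) : ℂ) = B' at *
  constructor
  · rw [div_mul_eq_mul_div, eq_div_iff hW, ← a₃, ← a₂]
    linear_combination -A' * a₁
  · rw [div_mul_eq_mul_div, eq_div_iff hW, ← a₃, ← a₂]
    linear_combination -B' * a₁

/-- The eigenvalues are real. -/
theorem IsEigenfunction.im_eq_zero {s : ℝ → ℝ} {f F : BoundaryCoeff} {z : ℂ} {y : ℝ → ℂ}
    (h : IsEigenfunction s f F z y) : z.im = 0 := by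
  by_contra hz
  have hπ := Real.pi_pos
  obtain ⟨⟨x₀, hx₀, hne⟩, u, hsol, h0, h1⟩ := h
  rw [isSolution_iff] at hsol
  obtain ⟨c₀, hc₀, e₀⟩ := h0.exists_im_eq hz
  obtain ⟨c₁, hc₁, e₁⟩ := h1.exists_im_eq hz
  have hconj := hsol.fst.clm_comp Complex.conjCLE.toContinuousLinearMap
  -- Lagrange identity: -Im(u ȳ) / Im z has derivative |y|². Its boundary values are c₀ ≥ 0 on the
  -- left and -c₁ ≤ 0 on the right, so this nondecreasing function is constant and y vanishes.
  have hw := ((hsol.snd.mul hconj).clm_comp Complex.imCLM).mul (.const z.im⁻¹ 0 Real.pi)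
  have hw' := hw.neg.congr_deriv (g' := fun x => Complex.normSq (y x)) (.of_forall fun x _ => by
    simp [Complex.normSq_apply]
    field_simp
    simp [pow_two]
    ring)
  have hmono := hw'.monotoneOn (.of_forall fun x _ => Complex.normSq_nonneg _)
  simp only [ContinuousLinearEquiv.coe_coe, Complex.conjCLE_apply, Complex.imCLM_apply] at hmono hw'
  rw [neg_mul, Complex.neg_im] at e₀
  have v₀ : -((u 0 * (starRingEnd ℂ) (y 0)).im * z.im⁻¹) = c₀ := by
    rw [← neg_mul, e₀]; field_simp
  have v₁ : -((u Real.pi * (starRingEnd ℂ) (y Real.pi)).im * z.im⁻¹) = -c₁ := by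
    rw [e₁]; field_simp
  have m0 : (0 : ℝ) ∈ Icc 0 Real.pi := left_mem_Icc.2 hπ.le
  have m1 : Real.pi ∈ Icc 0 Real.pi := right_mem_Icc.2 hπ.le
  have hconst : ∀ x ∈ Ioo 0 Real.pi, -((u x * (starRingEnd ℂ) (y x)).im * z.im⁻¹) = c₀ := by
    intro x hx
    have b₀ := hmono m0 (Ioo_subset_Icc_self hx) hx.1.le
    have b₁ := hmono (Ioo_subset_Icc_self hx) m1 hx.2.le
    simp only [v₀, v₁] at b₀ b₁
    linarith
  have hae := hw'.deriv_eq_zero_of_const hconst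
  exact hne (eq_zero_of_ae_eq_zero hπ (hsol.fst.continuousOn hπ.le) (by
    filter_upwards [hae] with x hx hx' using Complex.normSq_eq_zero.1 (hx hx')) x₀ hx₀)

theorem IsPruferAngle.isEigenfunction {s : ℝ → ℝ} {f F : BoundaryCoeff} {l : ℝ} {r θ : ℝ → ℝ}
    (hr : ∀ x, 0 < r x) (h₁ : IsACSolution s l
      (fun x => ((r x * Real.sin (θ x) : ℝ) : ℂ)) (fun x => ((r x * Real.cos (θ x) : ℝ) : ℂ)))
    (h0 : θ 0 = f.angle l) (hπ : Real.sin (θ Real.pi + F.angle l) = 0) :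
    IsEigenfunction s f F l (fun x => ((r x * Real.sin (θ x) : ℝ) : ℂ)) := by
  refine ⟨?_, _, isSolution_iff.2 h₁, ?_, ?_⟩
  -- If r sin θ ≡ 0, the first equation gives r cos θ = 0 almost everywhere too, contradicting sin²
  -- + cos² = 1.
  · by_contra! hzero
    have h := (h₁.fst.deriv_eq_zero_of_const fun x hx => hzero x (Ioo_subset_Icc_self hx))
    have h5 : volume (Ioo 0 Real.pi) = 0 := by
      rw [measure_eq_zero_iff_ae_notMem]
      filter_upwards [h] with t ht ht'
      have h6 := hzero t (Ioo_subset_Icc_self ht')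
      have h7 := ht ht'
      rw [h6, mul_zero, zero_add, Complex.ofReal_eq_zero, mul_eq_zero,
        or_iff_right (hr t).ne'] at h7
      rw [Complex.ofReal_eq_zero, mul_eq_zero, or_iff_right (hr t).ne'] at h6
      have := Real.sin_sq_add_cos_sq (θ t)
      rw [h6, h7] at this
      norm_num at this
    rw [Real.volume_Ioo] at h5
    simp only [ENNReal.ofReal_eq_zero] at h5
    linarith [Real.pi_pos]
  · rw [BoundaryCoeff.ratio_ofReal_iff, ← h0]
    push_cast
    ring
  · rw [BoundaryCoeff.ratio_ofReal_iff]
    rw [Real.sin_add] at hπ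
    have := congrArg (fun t : ℝ => (t : ℂ)) hπ
    push_cast at this ⊢
    linear_combination (r Real.pi : ℂ) * this

theorem IsEigenfunction.eq_mul_prufer {s : ℝ → ℝ}
    (hs : MemLp s 2 (volume.restrict (Ioo 0 Real.pi))) {f F : BoundaryCoeff} {l : ℝ} {y : ℝ → ℂ}
    (h : IsEigenfunction s f F l y) {θ : ℝ → ℝ} (hθ : IsPruferAngle s l θ)
    (h0 : θ 0 = f.angle l) :
    Real.sin (θ Real.pi + F.angle l) = 0 ∧
      ∀ x ∈ Icc 0 Real.pi, y x = 0 ↔ Real.sin (θ x) = 0 := by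
  obtain ⟨r, hr, h₁⟩ := hθ.exists_isACSolution hs
  obtain ⟨⟨x₀, hx₀, hne⟩, u, hsol, hb0, hb1⟩ := h
  rw [isSolution_iff] at hsol
  rw [BoundaryCoeff.ratio_ofReal_iff] at hb0 hb1
  obtain ⟨c, hc⟩ := hsol.eq_mul_prufer hs hr h₁ (by rw [h0]; linear_combination hb0)
  have hc0 : c ≠ 0 := by
    rintro rfl
    exact hne (by rw [(hc x₀ hx₀).1, zero_mul])
  constructor
  · obtain ⟨e₁, e₂⟩ := hc Real.pi (right_mem_Icc.2 Real.pi_pos.le)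
    rw [e₁, e₂] at hb1
    have : c * ((r Real.pi * Real.sin (θ Real.pi + F.angle l) : ℝ) : ℂ) = 0 := by
      rw [Real.sin_add]
      push_cast at hb1 ⊢
      linear_combination hb1
    rw [mul_eq_zero, or_iff_right hc0, Complex.ofReal_eq_zero, mul_eq_zero,
      or_iff_right (hr _).ne'] at this
    exact this
  · intro x hx
    rw [(hc x hx).1, mul_eq_zero, or_iff_right hc0, Complex.ofReal_eq_zero, mul_eq_zero,
      or_iff_right (hr _).ne']

/-! ### Counting zeros and numbering eigenvalues. -/

theorem IsPruferAngle.ncard_zeros {s : ℝ → ℝ}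
    (hs : MemLp s 2 (volume.restrict (Ioo 0 Real.pi))) {l : ℝ} {θ : ℝ → ℝ}
    (hθ : IsPruferAngle s l θ) {p q : ℤ} (hp : p * Real.pi ≤ θ 0) (hp' : θ 0 < (p + 1) * Real.pi)
    (hq : q * Real.pi < θ Real.pi) (hq' : θ Real.pi ≤ (q + 1) * Real.pi) :
    {x ∈ Ioo 0 Real.pi | Real.sin (θ x) = 0}.Finite ∧
      ({x ∈ Ioo 0 Real.pi | Real.sin (θ x) = 0}.ncard : ℤ) = q - p := by
  have hπ := Real.pi_pos
  have hinv : ∀ k : ℤ, ∀ x, θ x = k * Real.pi → ⌊θ x / Real.pi⌋ = k := fun k x h => by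
    rw [h, mul_div_cancel_right₀ _ hπ.ne', Int.floor_intCast]
  -- θ need not be monotone, but each multiple of π is attained at most once, so a zero is labelled
  -- by its multiple. The half-open hypotheses exclude zeros at the endpoints: pπ may be the value
  -- at 0, and (q + 1)π the value at π.
  have hbij : BijOn (fun x => ⌊θ x / Real.pi⌋) {x ∈ Ioo 0 Real.pi | Real.sin (θ x) = 0}
      (Finset.Icc (p + 1) q : Finset ℤ) := by
    refine ⟨?_, ?_, ?_⟩
    · rintro x ⟨hx, hx0⟩
      obtain ⟨k, hk⟩ := Real.sin_eq_zero_iff.1 hx0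
      simp only [hinv k x hk.symm, Finset.coe_Icc, mem_Icc]
      constructor
      · have h1 := hθ.lt_of_le_int_mul_pi hs le_rfl hx.1 hx.2.le hp
        rw [← hk, mul_lt_mul_iff_left₀ hπ] at h1
        exact_mod_cast h1
      · have h1 := hθ.lt_of_le_int_mul_pi hs hx.1.le hx.2 le_rfl hk.le
        have h2 := h1.trans_le hq'
        rw [mul_lt_mul_iff_left₀ hπ] at h2
        exact Int.lt_add_one_iff.1 (by exact_mod_cast h2)
    · rintro x ⟨hx, hx0⟩ x' ⟨hx', hx0'⟩ heq
      obtain ⟨k, hk⟩ := Real.sin_eq_zero_iff.1 hx0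
      obtain ⟨k', hk'⟩ := Real.sin_eq_zero_iff.1 hx0'
      simp only [hinv k x hk.symm, hinv k' x' hk'.symm] at heq
      subst heq
      rcases lt_trichotomy x x' with h | h | h
      · linarith [hθ.lt_of_le_int_mul_pi hs hx.1.le h hx'.2.le hk.le]
      · exact h
      · linarith [hθ.lt_of_le_int_mul_pi hs hx'.1.le h hx.2.le hk'.le]
    · intro k hk
      simp only [Finset.coe_Icc, mem_Icc] at hk
      have h1 : θ 0 < k * Real.pi := by
        have : ((p + 1 : ℤ) : ℝ) ≤ k := by exact_mod_cast hk.1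
        push_cast at this
        exact hp'.trans_le (by gcongr)
      have h2 : k * Real.pi < θ Real.pi := by
        have : (k : ℝ) ≤ q := by exact_mod_cast hk.2
        exact lt_of_le_of_lt (by gcongr) hq
      obtain ⟨x, hx, hxk⟩ := intermediate_value_Ioo hπ.le hθ.continuousOn ⟨h1, h2⟩
      exact ⟨x, ⟨hx, by rw [hxk]; exact Real.sin_int_mul_pi k⟩, hinv k x hxk⟩
  have hpq : p ≤ q := by
    have h1 := (hθ.lt_of_le_int_mul_pi hs le_rfl hπ le_rfl hp).trans_le hq'
    rw [mul_lt_mul_iff_left₀ hπ] at h1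
    exact Int.lt_add_one_iff.1 (by exact_mod_cast h1)
  refine ⟨hbij.finite_iff_finite.2 (Finset.finite_toSet _), ?_⟩
  rw [← hbij.injOn.ncard_image, hbij.image_eq, ncard_coe_finset, Int.card_Icc,
    Int.toNat_of_nonneg (by linarith)]
  ring

/-- T = θ(π) + angle of F is a strictly increasing continuous function of λ with 0 < T, T < π
somewhere, and no upper bound. Positivity makes π the lowest multiple that can occur, which fixes
the index n ↔ (n + 1)π. -/
theorem exists_eigenvalue_sequence {s : ℝ → ℝ}
    (hs : MemLp s 2 (volume.restrict (Ioo 0 Real.pi))) (f F : BoundaryCoeff) {θ : ℝ → ℝ → ℝ}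
    (h0 : ∀ l, θ l 0 = f.angle l) (hθ : ∀ l, IsPruferAngle s l (θ l)) :
    ∃ lam : ℕ → ℝ, StrictMono lam ∧
      (∀ n, θ (lam n) Real.pi + F.angle (lam n) = (n + 1) * Real.pi) ∧
      ∀ l, Real.sin (θ l Real.pi + F.angle l) = 0 → ∃ n, lam n = l := by
  have hπ := Real.pi_pos
  set T : ℝ → ℝ := fun l => θ l Real.pi + F.angle l with hT
  have hmono : StrictMono T := fun l l' hl =>
    add_lt_add_of_lt_of_le ((hθ l).strict_mono hs (hθ l') hl (by
      rw [h0, h0]; exact f.monotone_angle hl.le)) (F.monotone_angle hl.le)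
  have hpos : ∀ l, 0 < T l := fun l => by
    have := (hθ l).lt_of_le_int_mul_pi hs (k := 0) le_rfl hπ le_rfl (by
      rw [h0]; simpa using f.angle_nonneg l)
    exact add_pos_of_pos_of_nonneg (by simpa using this) (F.angle_nonneg l)
  have hcont : Continuous T := by
    refine Continuous.add (continuous_iff_continuousAt.2 fun l => ?_) F.continuous_angle
    rw [ContinuousAt, tendsto_iff_dist_tendsto_zero]
    -- The Lipschitz weight is taken at the base point l, so E stays fixed as l' → l.
    set E := Real.exp (∫ t in (0 : ℝ)..Real.pi, |pruferLip s l t|)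
    have hlim : Filter.Tendsto (fun l' => E * (|f.angle l' - f.angle l| +
        |l' - l| * E * (Real.pi - 0))) (nhds l) (nhds 0) := by
      have hc : Continuous fun l' => E * (|f.angle l' - f.angle l| +
          |l' - l| * E * (Real.pi - 0)) := by
        have := f.continuous_angle
        fun_prop
      simpa using hc.tendsto l
    refine squeeze_zero (fun _ => dist_nonneg) (fun l' => ?_) hlim
    have := (hθ l).abs_sub_le hs (hθ l')
    rwa [h0, h0] at this
  have hlow : ∃ l, T l < Real.pi := by
    obtain ⟨a, ha⟩ := f.exists_angle_lt_pi
    obtain ⟨b, hb⟩ := F.exists_angle_lt_pi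
    obtain ⟨l₀, hl₀⟩ := exists_pruferAngle_lt hs (f.angle_nonneg a) ha (sub_pos.2 hb)
    refine ⟨min (min a b) l₀, ?_⟩
    have h1 := hl₀ _ (min_le_right (min a b) l₀) _ (hθ _) (by
      rw [h0]; exact f.monotone_angle ((min_le_left _ _).trans (min_le_left _ _)))
    have h2 := F.monotone_angle ((min_le_left (min a b) l₀).trans (min_le_right _ _))
    simp only [hT]
    linarith
  have hhigh : ∀ M, ∃ l, M ≤ T l := fun M => by
    set I := ∫ x in (0 : ℝ)..Real.pi, |s x|
    set k := max 1 ((M + I + Real.pi) / Real.pi)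
    have hk : 0 < k := lt_of_lt_of_le one_pos (le_max_left _ _)
    have hk' : M + I + Real.pi ≤ k * Real.pi := (div_le_iff₀ hπ).1 (le_max_right _ _)
    have h1 := (hθ (k ^ 2)).lower_bound hs hk
    rw [h0] at h1
    refine ⟨k ^ 2, ?_⟩
    have h2 := f.angle_nonneg (k ^ 2)
    have h3 := F.angle_nonneg (k ^ 2)
    simp only [hT]
    linarith
  have hex : ∀ n : ℕ, ∃ l, T l = (n + 1) * Real.pi := fun n => by
    obtain ⟨a, ha⟩ := hlow
    obtain ⟨b, hb⟩ := hhigh ((n + 1) * Real.pi)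
    have hn : Real.pi ≤ (n + 1) * Real.pi := by nlinarith [Nat.cast_nonneg (α := ℝ) n]
    exact mem_range_of_exists_le_of_exists_ge hcont ⟨a, ha.le.trans hn⟩ ⟨b, hb⟩
  choose lam hlam using hex
  refine ⟨lam, fun m n hmn => ?_, hlam, fun l hl => ?_⟩
  · rw [← hmono.lt_iff_lt, hlam, hlam]
    gcongr
  · obtain ⟨k, hk⟩ := Real.sin_eq_zero_iff.1 hl
    have hk0 : 0 < k := by
      have : 0 < k * Real.pi := hk ▸ hpos l
      exact_mod_cast pos_of_mul_pos_left this hπ.le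
    refine ⟨(k - 1).toNat, hmono.injective ?_⟩
    rw [hlam]
    have : (((k - 1).toNat : ℤ) : ℝ) = k - 1 := by
      rw [Int.toNat_of_nonneg (by linarith)]
      push_cast
      ring
    rw [Int.cast_natCast] at this
    rw [this, sub_add_cancel, hk]

end DistSL

theorem theorem4p2 (s : ℝ → ℝ)
    (hs : MeasureTheory.MemLp s 2 (MeasureTheory.volume.restrict (Set.Ioo 0 Real.pi)))
    (f F : DistSL.BoundaryCoeff) :
    ∃ lam : ℕ → ℝ, StrictMono lam ∧
      Set.range (fun n => (lam n : ℂ)) = {z : ℂ | DistSL.IsEigenvalue s f F z} ∧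
      ∀ (n : ℕ) (y : ℝ → ℂ), DistSL.IsEigenfunction s f F (lam n : ℂ) y →
        {x ∈ Set.Ioo 0 Real.pi | y x = 0}.Finite ∧
        ({x ∈ Set.Ioo 0 Real.pi | y x = 0}.ncard : ℤ) =
          (n : ℤ) - (f.poleCount (lam n) : ℤ) - (F.poleCount (lam n) : ℤ) := by
  choose θ h0 hθ using fun l => DistSL.exists_isPruferAngle hs l (f.angle l)
  obtain ⟨lam, hmono, hlam, hall⟩ := DistSL.exists_eigenvalue_sequence hs f F h0 hθ
  refine ⟨lam, hmono, ?_, fun n y hy => ?_⟩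
  · ext z
    constructor
    · rintro ⟨n, rfl⟩
      obtain ⟨r, hr, h₁⟩ := (hθ (lam n)).exists_isACSolution hs
      refine ⟨_, DistSL.IsPruferAngle.isEigenfunction hr h₁ (h0 _) ?_⟩
      rw [hlam]
      exact_mod_cast Real.sin_nat_mul_pi (n + 1)
    · rintro ⟨y, hy⟩
      obtain ⟨l, rfl⟩ : ∃ l : ℝ, (l : ℂ) = z := ⟨z.re, Complex.ext rfl hy.im_eq_zero.symm⟩
      obtain ⟨n, hn⟩ := hall l (hy.eq_mul_prufer hs (hθ l) (h0 l)).1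
      exact ⟨n, by rw [← hn]⟩
  · have hz := (hy.eq_mul_prufer hs (hθ _) (h0 _)).2
    have hset : {x ∈ Ioo 0 Real.pi | y x = 0} =
        {x ∈ Ioo 0 Real.pi | Real.sin (θ (lam n) x) = 0} := by
      ext x
      exact and_congr_right fun hx => hz x (Ioo_subset_Icc_self hx)
    have a1 := f.poleCount_mul_pi_le_angle (lam n)
    have a2 := f.angle_lt (lam n)
    have b1 := F.poleCount_mul_pi_le_angle (lam n)
    have b2 := F.angle_lt (lam n)
    have e := hlam n
    -- Since the angle of F lies in [Π_F π, (Π_F + 1)π), θ(π) = (n + 1)π minus it lies in ((n -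
    -- Π_F)π, (n - Π_F + 1)π], which gives q; p is the integer part of θ(0) / π.
    obtain ⟨hfin, hcard⟩ := (hθ (lam n)).ncard_zeros hs
      (p := f.poleCount (lam n)) (q := (n : ℤ) - F.poleCount (lam n))
      (by rw [h0]; exact_mod_cast a1) (by rw [h0]; exact_mod_cast a2)
      (by push_cast; linarith) (by push_cast; linarith)
    rw [hset]
    exact ⟨hfin, by rw [hcard]; ring⟩
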